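/- Let $R$ be a commutative ring with unit and $X=\{x_1<\dots<x_n\}$ an ordered alphabet. Let $\mathcal{L}ie_2(n)$ be the multilinear part (the $R$-span of the monomials in which every letter occurs exactly once) of the free $R$-algebra on $X$ with two compatible Lie brackets $[\cdot,\cdot]$ and $\langle\cdot,\cdot\rangle$, i.e. two bilinear operations subject to antisymmetry and the Jacobi identity for each of them and to the mixed Jacobi identity $$[x,\langle y,z\rangle]+[y,\langle z,x\rangle]+[z,\langle x,y\rangle]+\langle x,[y,z]\rangle+\langle y,[z,x]\rangle+\langle z,[x,y]\rangle=0 .$$ For $0\le i\le n-1$ let $\mathcal{L}ie_2(n,i)\subseteq \mathcal{L}ie_2(n)$ be the submodule generated by the multilinear monomials with exactly $i$ brackets $[\cdot,\cdot]$. For a rooted tree on the vertex set $X$, an edge $\{x,y\}$ with $x$ the parent of $y$ is called increasing if $x<y$ and decreasing if $x>y$; color increasing edges red and decreasing edges blue. For a rooted tree $G$ on a nonempty subset of $X$, with root $r$, define the monomial $b_G$ recursively: if $G$ consists of $r$ alone, $b_G=r$. Otherwise let $c_1<\dots<c_k$ be the children of $r$ and $G_1,\dots,G_k$ the subtrees rooted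 at them. If $r<c_k$, let $c_j$ be the smallest child with $r<c_j$ and put $b_G=[b_{G\setminus G_j},b_{G_j}]$; if $r>c_k$, put $b_G=\langle b_{G_k},b_{G\setminus G_k}\rangle$. Then: 1. $\mathcal{L}ie_2(n)=\bigoplus_{i=0}^{n-1}\mathcal{L}ie_2(n,i)$. 2. For every $0\le i\le n-1$, coloring the edges and forgetting the root is a bijection from the set of rooted trees on $X$ with $i$ increasing edges to the set of trees on $X$ with edges colored red or blue, with exactly $i$ red edges, for which there are no $x<y<z$ in $X$ such that $\{x,z\},\{y,z\}$ are red edges, or $\{x,y\},\{x,z\}$ are blue edges, or $\{x,y\}$ is a red edge and $\{y,z\}$ a blue edge. 3. For every $0\le i\le n-1$, the family of the $b_G$, where $G$ runs over the rooted trees on $X$ with exactly $i$ increasing (red) edges, is an $R$-basis of $\mathcal{L}ie_2(n,i)$. Hence, if $R\neq 0$, the rank of $\mathcal{L}ie_2(n,i)$ is the number of rooted trees on the vertex set $X$ with exactly $i$ increasing edges. -/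

import Mathlib

namespace CompatibleLie

/-! ### The free algebra with two compatible Lie brackets -/

/-- The two kinds of brackets: `square` is `[·,·]` and `angle` is `⟨·,·⟩`. -/
inductive Kind : Type
  | square : Kind
  | angle : Kind
  deriving DecidableEq

/-- Formal bracketings of letters of the alphabet `X` by the two brackets. -/
inductive Monomial (X : Type) : Type
  | letter (x : X) : Monomial X
  | node (c : Kind) (a b : Monomial X) : Monomial X

namespace Monomial

/-- The list of letters of a monomial, read from left to right. -/
def letters {X : Type} : Monomial X → List X
  | letter x => [x]
  | node _ a b => a.letters ++ b.letters

/-- The number of brackets of kind `c` in a monomial. -/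
def count {X : Type} (c : Kind) : Monomial X → ℕ
  | letter _ => 0
  | node d a b => (if d = c then 1 else 0) + a.count c + b.count c

/-- A monomial is multilinear if every letter of the alphabet occurs in it exactly once. -/
def IsMultilinear {X : Type} [DecidableEq X] (m : Monomial X) : Prop :=
  ∀ x : X, m.letters.count x = 1

end Monomial

/-- The free `R`-module with two bilinear operations (and no relations) on the alphabet `X`. -/
noncomputable abbrev Magmatic (R : Type*) [CommRing R] (X : Type) := Monomial X →₀ R

/-- The two bilinear operations of `Magmatic R X`, extending `(a, b) ↦ node c a b`. -/
noncomputable def Magmatic.br (R : Type*) [CommRing R] {X : Type} (c : Kind) :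
    Magmatic R X →ₗ[R] Magmatic R X →ₗ[R] Magmatic R X :=
  Finsupp.linearCombination R (fun a => Finsupp.lmapDomain R R (fun b => Monomial.node c a b))

/-- The relators of a pair of compatible Lie brackets: antisymmetry and the Jacobi identity for
each bracket, the mixed Jacobi identity, and everything obtained from these by repeatedly
bracketing on either side with arbitrary elements. -/
inductive Relator (R : Type*) [CommRing R] (X : Type) : Magmatic R X → Prop
  | symm (c : Kind) (x y : Magmatic R X) :
      Relator R X (Magmatic.br R c x y + Magmatic.br R c y x)
  | jacobi (c : Kind) (x y z : Magmatic R X) :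
      Relator R X (Magmatic.br R c x (Magmatic.br R c y z)
        + Magmatic.br R c y (Magmatic.br R c z x)
        + Magmatic.br R c z (Magmatic.br R c x y))
  | mixed (x y z : Magmatic R X) :
      Relator R X (Magmatic.br R .square x (Magmatic.br R .angle y z)
        + Magmatic.br R .square y (Magmatic.br R .angle z x)
        + Magmatic.br R .square z (Magmatic.br R .angle x y)
        + Magmatic.br R .angle x (Magmatic.br R .square y z)
        + Magmatic.br R .angle y (Magmatic.br R .square z x)
        + Magmatic.br R .angle z (Magmatic.br R .square x y))
  | left (c : Kind) (u f : Magmatic R X) : Relator R X f → Relator R X (Magmatic.br R c u f)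
  | right (c : Kind) (u f : Magmatic R X) : Relator R X f → Relator R X (Magmatic.br R c f u)

/-- The ideal (two-sided, for both operations) generated by the relations. -/
noncomputable def relations (R : Type*) [CommRing R] (X : Type) : Submodule R (Magmatic R X) :=
  Submodule.span R {f | Relator R X f}

/-- The free algebra over `R` on the alphabet `X` with two compatible Lie brackets. -/
noncomputable abbrev FreeLie2 (R : Type*) [CommRing R] (X : Type) := Magmatic R X ⧸ relations R X

/-- The element of the free algebra given by a monomial. -/
noncomputable def mon (R : Type*) [CommRing R] {X : Type} (m : Monomial X) : FreeLie2 R X :=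
  (relations R X).mkQ (Finsupp.single m 1)

/-- `Lie_2(n)`: the multilinear part of the free algebra with two compatible Lie brackets on
`n` ordered letters. -/
noncomputable def Lie2 (R : Type*) [CommRing R] (n : ℕ) : Submodule R (FreeLie2 R (Fin n)) :=
  Submodule.span R {u | ∃ m : Monomial (Fin n), m.IsMultilinear ∧ u = mon R m}

/-- `Lie_2(n, i)`: the submodule of `Lie_2(n)` generated by the multilinear monomials with exactly
`i` brackets `[·,·]`. -/
noncomputable def Lie2Part (R : Type*) [CommRing R] (n i : ℕ) : Submodule R (Lie2 R n) :=
  Submodule.span R {u | ∃ m : Monomial (Fin n), m.IsMultilinear ∧ m.count .square = i ∧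
    (u : FreeLie2 R (Fin n)) = mon R m}

/-! ### Rooted trees and two-colored trees -/

/-- Rooted trees on the vertex set `Fin n`. -/
structure RootedTree (n : ℕ) where
  graph : SimpleGraph (Fin n)
  isTree : graph.IsTree
  root : Fin n

namespace RootedTree

/-- `i` is the parent of `j`: they are joined by an edge and `i` is closer to the root. -/
def IsParent {n : ℕ} (T : RootedTree n) (i j : Fin n) : Prop :=
  T.graph.Adj i j ∧ T.graph.dist T.root i < T.graph.dist T.root j

/-- The increasing edges `{i, j}`: `i` is the parent of `j` and `i < j`. -/
def increasingEdges {n : ℕ} (T : RootedTree n) : Set (Sym2 (Fin n)) :=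
  {e | ∃ i j, e = s(i, j) ∧ T.IsParent i j ∧ i < j}

/-- The number of increasing edges of a rooted tree. -/
noncomputable def numIncreasing {n : ℕ} (T : RootedTree n) : ℕ := T.increasingEdges.ncard

end RootedTree

/-- Connected graphs on `Fin n` with edges colored red or blue: the edges of the subgraph `red`
are the red edges, all the other edges are blue. -/
structure TwoColoredGraph (n : ℕ) where
  graph : SimpleGraph (Fin n)
  connected : graph.Connected
  red : SimpleGraph (Fin n)
  red_le : red ≤ graph

namespace TwoColoredGraph

/-- The graph formed by the blue edges. -/
def blue {n : ℕ} (G : TwoColoredGraph n) : SimpleGraph (Fin n) := G.graph \ G.red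

/-- The number of red edges. -/
noncomputable def numRed {n : ℕ} (G : TwoColoredGraph n) : ℕ := G.red.edgeSet.ncard

/-- The two-colored trees on `Fin n` that avoid the patterns `1r3r2`, `2b1b3` and `1r2b3`. -/
def avoidingTrees (n : ℕ) : Set (TwoColoredGraph n) :=
  {G | G.graph.IsTree ∧
    (¬ ∃ i j k, i < j ∧ j < k ∧ G.red.Adj i k ∧ G.red.Adj j k) ∧
    (¬ ∃ i j k, i < j ∧ j < k ∧ G.blue.Adj i j ∧ G.blue.Adj i k) ∧
    (¬ ∃ i j k, i < j ∧ j < k ∧ G.red.Adj i j ∧ G.blue.Adj j k)}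

end TwoColoredGraph

/-- The color map: the increasing edges of a rooted tree are colored red, and its other edges
(the decreasing ones) are colored blue; the root is forgotten. -/
def RootedTree.color {n : ℕ} (T : RootedTree n) : TwoColoredGraph n where
  graph := T.graph
  connected := T.isTree.connected
  red := SimpleGraph.fromEdgeSet T.increasingEdges
  red_le := by
    intro a b h
    rw [SimpleGraph.fromEdgeSet_adj] at h
    obtain ⟨⟨i, j, e, ⟨hp, -⟩, -⟩, -⟩ := h
    rw [← SimpleGraph.mem_edgeSet, e]
    exact hp

/-! ### The monomials `b_G` -/

theorem ncard_deleteEdges_lt {n : ℕ} {H : SimpleGraph (Fin n)} {r c : Fin n} (h : H.Adj r c) :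
    (H.deleteEdges {s(r, c)}).edgeSet.ncard < H.edgeSet.ncard := by
  rw [SimpleGraph.edgeSet_deleteEdges]
  exact Set.ncard_sdiff_singleton_lt_of_mem ((SimpleGraph.mem_edgeSet H).2 h) (Set.toFinite _)

open Classical in
/-- The monomial attached to the connected component of `r` in the forest `H`, rooted at `r`.
If `c` is a neighbor of `r`, then after deletion of the edge `{r, c}` the component of `c` is the
subtree `G_c` of the child `c`, and the component of `r` is `G \ G_c`.
If some child of `r` is larger than `r`, let `c` be the smallest such child; the monomial is
`[b_{G \ G_c}, b_{G_c}]`. Otherwise, if `r` has a child, let `c` be the largest one; the monomial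
is `⟨b_{G_c}, b_{G \ G_c}⟩`. If `r` has no child, the monomial is the letter `r`. -/
noncomputable def forestMonomial {n : ℕ} (H : SimpleGraph (Fin n)) (r : Fin n) :
    Monomial (Fin n) :=
  if h : (Finset.univ.filter fun c => H.Adj r c ∧ r < c).Nonempty then
    let c := (Finset.univ.filter fun c => H.Adj r c ∧ r < c).min' h
    Monomial.node .square (forestMonomial (H.deleteEdges {s(r, c)}) r)
      (forestMonomial (H.deleteEdges {s(r, c)}) c)
  else if h' : (Finset.univ.filter fun c => H.Adj r c).Nonempty then
    let c := (Finset.univ.filter fun c => H.Adj r c).max' h'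
    Monomial.node .angle (forestMonomial (H.deleteEdges {s(r, c)}) c)
      (forestMonomial (H.deleteEdges {s(r, c)}) r)
  else Monomial.letter r
termination_by H.edgeSet.ncard
decreasing_by
  all_goals apply ncard_deleteEdges_lt
  · exact (Finset.mem_filter.1 (Finset.min'_mem _ h)).2.1
  · exact (Finset.mem_filter.1 (Finset.min'_mem _ h)).2.1
  · exact (Finset.mem_filter.1 (Finset.max'_mem _ h')).2
  · exact (Finset.mem_filter.1 (Finset.max'_mem _ h')).2

/-- The monomial `b_G` of a rooted tree `G`. -/
noncomputable def RootedTree.monomial {n : ℕ} (T : RootedTree n) : Monomial (Fin n) :=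
  forestMonomial T.graph T.root

end CompatibleLie

/-! A monomial encodes a rooted tree: each bracket joins the roots of its two factors by an edge,
the parent being the left root for `square` and the right root for `angle`. The monomials b_G are
the `Normal` ones, in which the two roots are in increasing order at every bracket and the children
of a vertex are attached in the prescribed order.

Spanning. Every multilinear monomial is rewritten, by antisymmetry, Jacobi and mixed Jacobi, as a
combination of normal monomials with the same letters and the same number of square brackets
(`straightens`, `mon_mem_monSpan_normal`). The induction is on the size and then downwards on the
smaller of the two roots; it works because straightening never produces a root below that minimum.

Independence. Grafting one tree at the vertices of another, weighted by a function of the new edge,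
satisfies a pre-Lie identity which allows two different weights (`graftProd_preLie`). Taking as
weights the indicators of increasing and of decreasing edges, the two commutators are compatible Lie
brackets on the span of trees, so the free algebra maps to this span. Every rooted tree lies in the
image (`single_mem_treeImage`). Hence R^trees → `Lie2` → R^trees, the first map given by the b_G, is
a surjective endomorphism of a finitely generated module over a commutative ring. It is therefore
injective, and so the b_G are independent (`linearIndependent_treeMon`). No triangularity between
the b_G and the trees is needed.

Since b_G has as many square brackets as G has increasing edges, sorting this basis gives the direct
sum and the bases of the summands. The colored trees are a separate matter: colors and the order of
the letters orient each edge, and the three forbidden patterns are the three ways in which a vertex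
could have two parents. -/

namespace CompatibleLie

/-! ### Monomials as encodings of rooted trees -/

namespace Monomial

/-- The root of the rooted tree encoded by a monomial. -/
def root {X : Type} : Monomial X → X
  | letter x => x
  | node .square a _ => a.root
  | node .angle _ b => b.root

/-- The edges `(parent, child)` of the rooted tree encoded by a monomial. -/
def edges {X : Type} : Monomial X → Multiset (X × X)
  | letter _ => 0
  | node .square a b => (a.root, b.root) ::ₘ (a.edges + b.edges)
  | node .angle a b => (b.root, a.root) ::ₘ (a.edges + b.edges)

/-- The multiset of letters of a monomial. -/
def content {X : Type} : Monomial X → Multiset X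
  | letter x => {x}
  | node _ a b => a.content + b.content

/-- The number of letters of a monomial. -/
def size {X : Type} : Monomial X → ℕ
  | letter _ => 1
  | node _ a b => a.size + b.size

/-- If the monomial is a bracket `[a, b]`, then `u` is at most the root of `b`. -/
def SquareBound {X : Type} [LE X] (u : X) : Monomial X → Prop
  | node .square _ b => u ≤ b.root
  | _ => True

/-- The monomial is a letter, or a bracket `⟨a, b⟩` such that the root of `a` is at most `u`. -/
def AngleBound {X : Type} [LE X] (u : X) : Monomial X → Prop
  | letter _ => True
  | node .angle a _ => a.root ≤ u
  | node .square _ _ => False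

/-- Normal monomials: those that arise as monomials of rooted trees. -/
def Normal {X : Type} [LT X] [LE X] : Monomial X → Prop
  | letter _ => True
  | node .square a b => a.Normal ∧ b.Normal ∧ a.root < b.root ∧ a.SquareBound b.root
  | node .angle a b => a.Normal ∧ b.Normal ∧ a.root < b.root ∧ b.AngleBound a.root

theorem coe_letters {X : Type} (m : Monomial X) : (m.letters : Multiset X) = m.content := by
  induction m with
  | letter x => rfl
  | node c a b iha ihb => rw [letters, ← Multiset.coe_add, iha, ihb, content]

theorem card_content {X : Type} (m : Monomial X) : m.content.card = m.size := by
  induction m with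
  | letter x => rfl
  | node c a b iha ihb => rw [content, Multiset.card_add, iha, ihb, size]

theorem size_pos {X : Type} (m : Monomial X) : 0 < m.size := by
  induction m with
  | letter x => exact Nat.one_pos
  | node c a b iha ihb => exact Nat.add_pos_left iha _

theorem count_square_lt_size {X : Type} (m : Monomial X) : m.count .square < m.size := by
  induction m with
  | letter x => exact Nat.one_pos
  | node c a b iha ihb => simp only [count, size]; split_ifs <;> omega

theorem root_mem_content {X : Type} (m : Monomial X) : m.root ∈ m.content := by
  induction m with
  | letter x => exact Multiset.mem_singleton_self x
  | node c a b iha ihb =>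
    cases c
    · exact Multiset.mem_add.2 (.inl iha)
    · exact Multiset.mem_add.2 (.inr ihb)

theorem root_ne_of_nodup {X : Type} {a b : Monomial X} (h : (a.content + b.content).Nodup) :
    a.root ≠ b.root := fun e =>
  Multiset.disjoint_left.1 (Multiset.nodup_add.1 h).2.2 a.root_mem_content
    (e ▸ b.root_mem_content)

theorem SquareBound.mono {X : Type} [Preorder X] {u v : X} {m : Monomial X} (h : u ≤ v)
    (hm : m.SquareBound v) : m.SquareBound u := by
  rcases m with x | ⟨_ | _, a, b⟩
  · trivial
  · exact h.trans hm
  · trivial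

end Monomial

open Monomial

/-! ### The brackets of the free algebra -/

section Brackets

variable {R : Type*} [CommRing R] {X : Type}

theorem relations_br_left (c : Kind) (u : Magmatic R X) {f : Magmatic R X}
    (hf : f ∈ relations R X) : Magmatic.br R c u f ∈ relations R X := by
  induction hf using Submodule.span_induction with
  | mem f hf => exact Submodule.subset_span (Relator.left c u f hf)
  | zero => simp
  | add f g _ _ hf hg => rw [map_add]; exact add_mem hf hg
  | smul r f _ hf => rw [map_smul]; exact Submodule.smul_mem _ _ hf

theorem relations_br_right (c : Kind) (u : Magmatic R X) {f : Magmatic R X}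
    (hf : f ∈ relations R X) : Magmatic.br R c f u ∈ relations R X := by
  induction hf using Submodule.span_induction with
  | mem f hf => exact Submodule.subset_span (Relator.right c u f hf)
  | zero => simp
  | add f g _ _ hf hg => rw [map_add, LinearMap.add_apply]; exact add_mem hf hg
  | smul r f _ hf => rw [map_smul, LinearMap.smul_apply]; exact Submodule.smul_mem _ _ hf

/-- The two brackets of the free algebra. -/
noncomputable def bracket (R : Type*) [CommRing R] {X : Type} (c : Kind) :
    FreeLie2 R X →ₗ[R] FreeLie2 R X →ₗ[R] FreeLie2 R X :=
  (relations R X).liftQ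
    { toFun := fun u => (relations R X).mapQ (relations R X) (Magmatic.br R c u)
        fun _ hf => relations_br_left c u hf
      map_add' := fun u v => by ext; simp
      map_smul' := fun r u => by ext; simp }
    (fun f hf => by
      rw [LinearMap.mem_ker]
      refine LinearMap.ext fun g => ?_
      obtain ⟨g, rfl⟩ := Submodule.mkQ_surjective _ g
      simpa using relations_br_right c g hf)

theorem bracket_mkQ (c : Kind) (u v : Magmatic R X) :
    bracket R c ((relations R X).mkQ u) ((relations R X).mkQ v) =
      (relations R X).mkQ (Magmatic.br R c u v) := rfl

theorem Magmatic.br_single (c : Kind) (a b : Monomial X) :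
    Magmatic.br R c (Finsupp.single a 1) (Finsupp.single b 1) =
      Finsupp.single (Monomial.node c a b) 1 := by
  simp [Magmatic.br]

theorem bracket_mon (c : Kind) (a b : Monomial X) :
    bracket R c (mon R a) (mon R b) = mon R (.node c a b) := by
  rw [mon, mon, bracket_mkQ, Magmatic.br_single, mon]

theorem mkQ_eq_zero_of_relator {f : Magmatic R X} (h : Relator R X f) :
    (relations R X).mkQ f = 0 := by
  rw [Submodule.mkQ_apply, Submodule.Quotient.mk_eq_zero]
  exact Submodule.subset_span h

theorem bracket_symm (c : Kind) (x y : FreeLie2 R X) :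
    bracket R c x y + bracket R c y x = 0 := by
  obtain ⟨x, rfl⟩ := Submodule.mkQ_surjective _ x
  obtain ⟨y, rfl⟩ := Submodule.mkQ_surjective _ y
  exact mkQ_eq_zero_of_relator (Relator.symm c x y)

theorem bracket_jacobi (c : Kind) (x y z : FreeLie2 R X) :
    bracket R c x (bracket R c y z) + bracket R c y (bracket R c z x)
      + bracket R c z (bracket R c x y) = 0 := by
  obtain ⟨x, rfl⟩ := Submodule.mkQ_surjective _ x
  obtain ⟨y, rfl⟩ := Submodule.mkQ_surjective _ y
  obtain ⟨z, rfl⟩ := Submodule.mkQ_surjective _ z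
  exact mkQ_eq_zero_of_relator (Relator.jacobi c x y z)

theorem bracket_mixed (x y z : FreeLie2 R X) :
    bracket R .square x (bracket R .angle y z) + bracket R .square y (bracket R .angle z x)
      + bracket R .square z (bracket R .angle x y) + bracket R .angle x (bracket R .square y z)
      + bracket R .angle y (bracket R .square z x)
      + bracket R .angle z (bracket R .square x y) = 0 := by
  obtain ⟨x, rfl⟩ := Submodule.mkQ_surjective _ x
  obtain ⟨y, rfl⟩ := Submodule.mkQ_surjective _ y
  obtain ⟨z, rfl⟩ := Submodule.mkQ_surjective _ z
  exact mkQ_eq_zero_of_relator (Relator.mixed x y z)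

theorem bracket_swap (c : Kind) (x y : FreeLie2 R X) :
    bracket R c x y = - bracket R c y x :=
  eq_neg_of_add_eq_zero_left (bracket_symm c x y)

theorem bracket_bracket_left (c : Kind) (x y z : FreeLie2 R X) :
    bracket R c (bracket R c x y) z =
      bracket R c (bracket R c x z) y + bracket R c x (bracket R c y z) := by
  have h := bracket_jacobi c x y z
  rw [bracket_swap c y (bracket R c z x), bracket_swap c z (bracket R c x y),
    bracket_swap c z x, map_neg, LinearMap.neg_apply, neg_neg] at h
  rw [← sub_eq_zero, ← neg_eq_zero, ← h]; abel

theorem bracket_bracket_right (c : Kind) (x y z : FreeLie2 R X) :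
    bracket R c x (bracket R c y z) =
      bracket R c (bracket R c x y) z + bracket R c y (bracket R c x z) := by
  have h := bracket_jacobi c x y z
  rw [bracket_swap c z (bracket R c x y), bracket_swap c z x, map_neg] at h
  rw [← sub_eq_zero, ← h]; abel

end Brackets

/-! ### Straightening into normal monomials -/

section Straightening

variable (R : Type*) [CommRing R] {X : Type}

/-- The submodule spanned by the monomials with a given property. -/
noncomputable def monSpan (P : Monomial X → Prop) : Submodule R (FreeLie2 R X) :=
  Submodule.span R {u | ∃ m, P m ∧ u = mon R m}

variable {R}

theorem mon_mem_monSpan {P : Monomial X → Prop} {m : Monomial X} (h : P m) :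
    mon R m ∈ monSpan R P :=
  Submodule.subset_span ⟨m, h, rfl⟩

theorem monSpan_mono {P Q : Monomial X → Prop} (h : ∀ m, P m → Q m) :
    monSpan R P ≤ monSpan R Q :=
  Submodule.span_mono fun _ ⟨m, hm, e⟩ => ⟨m, h m hm, e⟩

theorem map_mem_of_mem_monSpan {M : Type*} [AddCommGroup M] [Module R M] {W : Submodule R M}
    (f : FreeLie2 R X →ₗ[R] M) {P : Monomial X → Prop} {x : FreeLie2 R X}
    (hx : x ∈ monSpan R P) (h : ∀ m, P m → f (mon R m) ∈ W) : f x ∈ W := by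
  have : monSpan R P ≤ W.comap f := Submodule.span_le.2 fun _ ⟨m, hm, e⟩ => e ▸ h m hm
  exact this hx

theorem bracket_mem_left {W : Submodule R (FreeLie2 R X)} {P : Monomial X → Prop} {c : Kind}
    {x y : FreeLie2 R X} (hx : x ∈ monSpan R P)
    (h : ∀ m, P m → bracket R c (mon R m) y ∈ W) : bracket R c x y ∈ W :=
  map_mem_of_mem_monSpan ((bracket R c).flip y) hx h

theorem bracket_mem_right {W : Submodule R (FreeLie2 R X)} {P : Monomial X → Prop} {c : Kind}
    {x y : FreeLie2 R X} (hx : x ∈ monSpan R P)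
    (h : ∀ m, P m → bracket R c y (mon R m) ∈ W) : bracket R c y x ∈ W :=
  map_mem_of_mem_monSpan (bracket R c y) hx h

/-- The number of square brackets contributed by a bracket. -/
def Kind.weight : Kind → ℕ
  | .square => 1
  | .angle => 0

theorem Monomial.count_square_node (c : Kind) (a b : Monomial X) :
    (node c a b).count .square = a.count .square + b.count .square + c.weight := by
  cases c
  · simp only [count, Kind.weight, if_true]; omega
  · simp [count, Kind.weight]

variable [LinearOrder X]

/-- The normal monomials with given letters, given number of square brackets, and root at
least `ρ`. -/
def NormalAbove (ρ : X) (S : Multiset X) (i : ℕ) (m : Monomial X) : Prop :=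
  m.Normal ∧ m.content = S ∧ m.count .square = i ∧ ρ ≤ m.root

variable (R) in
/-- The bracket of `a` and `b` is a combination of normal monomials with root at least `ρ`. -/
def BracketMem (c : Kind) (ρ : X) (a b : Monomial X) : Prop :=
  bracket R c (mon R a) (mon R b) ∈ monSpan R (NormalAbove ρ (a.content + b.content)
    (a.count .square + b.count .square + c.weight))

variable (R) in
/-- The square bracket of `a` and `b` is a combination of normal monomials whose root is larger
than that of `a`, or equal to it with the same bounds on its larger children. -/
def SquareMem (a b : Monomial X) : Prop :=
  bracket R .square (mon R a) (mon R b) ∈ monSpan R fun m =>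
    NormalAbove a.root (a.content + b.content) (a.count .square + b.count .square + 1) m ∧
      (m.root = a.root → ∀ u, a.SquareBound u → u ≤ b.root → m.SquareBound u)

theorem SquareMem.bracketMem {a b : Monomial X} (h : SquareMem R a b) :
    BracketMem R .square a.root a b :=
  monSpan_mono (fun _ hm => hm.1) h

theorem BracketMem.mono {c : Kind} {ρ σ : X} {a b : Monomial X} (h : BracketMem R c ρ a b)
    (hσ : σ ≤ ρ) : BracketMem R c σ a b :=
  monSpan_mono (fun _ hm => ⟨hm.1, hm.2.1, hm.2.2.1, hσ.trans hm.2.2.2⟩) h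

theorem BracketMem.symm {c : Kind} {ρ : X} {a b : Monomial X} (h : BracketMem R c ρ a b) :
    BracketMem R c ρ b a := by
  rw [BracketMem, bracket_swap, add_comm b.content, add_comm (b.count _)]
  exact neg_mem h

variable (R) in
/-- Both brackets of `a` and `b` can be straightened. -/
def Straightens (a b : Monomial X) : Prop :=
  a.Normal → b.Normal → (a.content + b.content).Nodup → a.root < b.root →
    SquareMem R a b ∧ BracketMem R .angle a.root a b

/-- `Straightens` only treats factors with roots in increasing order; antisymmetry gives the other
order, and the roots differ because no letter is repeated. -/
theorem bracketMem_of_straightens {a b : Monomial X} {ρ : X} (ha : a.Normal) (hb : b.Normal)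
    (h : (a.content + b.content).Nodup) (hρa : ρ ≤ a.root) (hρb : ρ ≤ b.root)
    (hab : a.root < b.root → Straightens R a b) (hba : b.root < a.root → Straightens R b a)
    (c : Kind) : BracketMem R c ρ a b := by
  rcases lt_or_gt_of_ne (root_ne_of_nodup h) with hlt | hlt
  · obtain ⟨h1, h2⟩ := hab hlt ha hb h hlt
    cases c
    · exact h1.bracketMem.mono hρa
    · exact h2.mono hρa
  · obtain ⟨h1, h2⟩ := hba hlt hb ha (add_comm a.content b.content ▸ h) hlt
    cases c
    · exact (h1.bracketMem.mono hρb).symm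
    · exact (h2.mono hρb).symm

section Step

variable {N : ℕ} {c : X}
  (hsmall : ∀ a b : Monomial X, a.size + b.size < N → Straightens R a b)
  (hroot : ∀ a b : Monomial X, a.size + b.size = N → c < a.root → Straightens R a b)

include hsmall in
theorem bracketMem_small {a b : Monomial X} {ρ : X} (hN : a.size + b.size < N) (ha : a.Normal)
    (hb : b.Normal) (h : (a.content + b.content).Nodup) (hρa : ρ ≤ a.root) (hρb : ρ ≤ b.root)
    (k : Kind) : BracketMem R k ρ a b :=
  bracketMem_of_straightens ha hb h hρa hρb (fun _ => hsmall a b hN)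
    (fun _ => hsmall b a (add_comm a.size b.size ▸ hN)) k

include hroot in
theorem bracketMem_of_lt_root {a b : Monomial X} {ρ : X} (hN : a.size + b.size = N)
    (ha : a.Normal) (hb : b.Normal) (h : (a.content + b.content).Nodup) (hca : c < a.root)
    (hcb : c < b.root) (hρa : ρ ≤ a.root) (hρb : ρ ≤ b.root) (k : Kind) :
    BracketMem R k ρ a b :=
  bracketMem_of_straightens ha hb h hρa hρb (fun _ => hroot a b hN hca)
    (fun _ => hroot b a (add_comm a.size b.size ▸ hN) hcb) k

end Step

theorem squareMem_of_normal {a b : Monomial X} (h : (node .square a b).Normal) :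
    SquareMem R a b := by
  rw [SquareMem, bracket_mon]
  exact mon_mem_monSpan ⟨⟨h, rfl, count_square_node _ _ _, le_rfl⟩, fun _ _ _ hu => hu⟩

theorem bracketMem_angle_of_normal {a b : Monomial X} {ρ : X} (h : (node .angle a b).Normal)
    (hρ : ρ ≤ b.root) : BracketMem R .angle ρ a b := by
  rw [BracketMem, bracket_mon]
  exact mon_mem_monSpan ⟨h, rfl, count_square_node _ _ _, hρ⟩

/-- The inner bracket is straightened first. Of each resulting monomial `L` only normality, letters,
size and the lower bound on the root are remembered, which is all that the induction on size and
root consumes. -/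
theorem bracket_bracket_mem_left {k l : Kind} {x y z : Monomial X} {ρ : X} {S : Multiset X}
    {i : ℕ} (hxy : BracketMem R k ρ x y)
    (hz : ∀ L : Monomial X, L.Normal → L.content = x.content + y.content →
      L.size = x.size + y.size → ρ ≤ L.root → BracketMem R l ρ L z)
    (hS : x.content + y.content + z.content = S)
    (hi : x.count .square + y.count .square + z.count .square + k.weight + l.weight = i) :
    bracket R l (bracket R k (mon R x) (mon R y)) (mon R z) ∈ monSpan R (NormalAbove ρ S i) := by
  refine bracket_mem_left hxy fun L ⟨hLn, hLc, hLi, hLr⟩ => ?_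
  refine monSpan_mono ?_ (hz L hLn hLc ?_ hLr)
  · rintro m ⟨hm1, hm2, hm3, hm4⟩
    refine ⟨hm1, by rw [hm2, hLc, hS], by omega, hm4⟩
  · simp only [← card_content, hLc, Multiset.card_add]

theorem bracket_bracket_mem_right {k l : Kind} {x y z : Monomial X} {ρ : X} {S : Multiset X}
    {i : ℕ} (hxy : BracketMem R k ρ x y)
    (hz : ∀ L : Monomial X, L.Normal → L.content = x.content + y.content →
      L.size = x.size + y.size → ρ ≤ L.root → BracketMem R l ρ z L)
    (hS : x.content + y.content + z.content = S)
    (hi : x.count .square + y.count .square + z.count .square + k.weight + l.weight = i) :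
    bracket R l (mon R z) (bracket R k (mon R x) (mon R y)) ∈ monSpan R (NormalAbove ρ S i) := by
  rw [bracket_swap]
  exact neg_mem (bracket_bracket_mem_left hxy (fun L h1 h2 h3 h4 => (hz L h1 h2 h3 h4).symm) hS hi)

/-! ### The inductive step of the straightening -/

section Step

variable {N : ℕ} {c : X}
  (hsmall : ∀ a b : Monomial X, a.size + b.size < N → Straightens R a b)
  (hroot : ∀ a b : Monomial X, a.size + b.size = N → c < a.root → Straightens R a b)

include hsmall hroot

/-- The bracket fails to be normal only if a = [H, U] with the root of U below that of K. Then
Jacobi gives [[H, U], K] = [[H, K], U] + [H, [U, K]]: the first term attaches the children in the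
right order, and the second has the shorter left factor H, hence the structural induction on `a`.
The clause of `SquareMem` on `SquareBound` is what makes the first term normal once [H, K] has been
straightened. -/
theorem squareMem_step (a K : Monomial X) (hN : a.size + K.size = N) (hc : a.root = c)
    (ha : a.Normal) (hK : K.Normal) (hnd : (a.content + K.content).Nodup) (hlt : c < K.root) :
    SquareMem R a K := by
  induction a generalizing K with
  | letter x => exact squareMem_of_normal ⟨ha, hK, hc.trans_lt hlt, trivial⟩
  | node k H U ihH _ =>
    cases k with
    | angle => exact squareMem_of_normal ⟨ha, hK, hc.trans_lt hlt, trivial⟩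
    | square =>
      by_cases hKU : K.root ≤ U.root
      · exact squareMem_of_normal ⟨ha, hK, hc.trans_lt hlt, hKU⟩
      rw [not_le] at hKU
      obtain ⟨hH, hU, hHU, hbd⟩ := ha
      change H.root = c at hc
      rw [hc] at hHU
      have e1 : (H.content + K.content) + U.content =
        (node Kind.square H U).content + K.content := add_right_comm _ _ _
      have e2 : H.content + (U.content + K.content) =
        (node Kind.square H U).content + K.content := (add_assoc _ _ _).symm
      have hHp := H.size_pos
      have hUp := U.size_pos
      have hKp := K.size_pos
      simp only [size] at hN
      rw [SquareMem, ← bracket_mon, bracket_bracket_left]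
      refine add_mem ?_ ?_
      · have hnd' := hnd
        rw [← e1] at hnd'
        have hHK := (hsmall H K (by omega) hH hK (Multiset.nodup_add.1 hnd').1
          (hc.trans_lt hlt)).1
        refine bracket_mem_left hHK fun M ⟨⟨hMn, hMc, hMi, hMr⟩, hMb⟩ => ?_
        have hMs : M.size + U.size = N := by
          rw [← card_content, hMc, Multiset.card_add, card_content, card_content]; omega
        -- If M keeps the root c, its bound at the root of U is inherited from H, so [M, U] is
        -- already normal. If the root of M has grown, both factors have roots above c and the
        -- induction on roots applies.
        rcases hMr.eq_or_lt with hM | hM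
        · rw [bracket_mon]
          refine mon_mem_monSpan ⟨⟨⟨hMn, hU, ?_, hMb hM.symm _ hbd hKU.le⟩, ?_, ?_, ?_⟩, ?_⟩
          · rw [← hM, hc]; exact hHU
          · rw [content, hMc, e1]
          · simp only [count_square_node, hMi, Kind.weight]; omega
          · exact hM.le
          · exact fun _ u hu _ => hu
        · refine monSpan_mono ?_ (bracketMem_of_lt_root hroot hMs hMn hU (hMc ▸ hnd')
            (hc ▸ hM) hHU (min_le_left _ _) (min_le_right _ _) .square)
          rintro m ⟨hm1, hm2, hm3, hm4⟩
          -- The root is now strictly above c, so the clause about monomials with root c is vacuous.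
          have hm5 : c < m.root := (lt_min (hc ▸ hM) hHU).trans_le hm4
          refine ⟨⟨hm1, ?_, ?_, ?_⟩, fun h => absurd (h.trans hc) hm5.ne'⟩
          · rw [hm2, hMc, e1]
          · simp only [hm3, count_square_node, hMi, Kind.weight]; omega
          · exact hc.trans_le hm5.le
      · have hnd' := hnd
        rw [← e2] at hnd'
        have hUK := (hsmall U K (by omega) hU hK (Multiset.nodup_add.1 hnd').2.1 hKU).1
        refine bracket_mem_right hUK fun L ⟨⟨hLn, hLc, hLi, hLr⟩, _⟩ => ?_
        have hLs : H.size + L.size = N := by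
          rw [← card_content L, hLc, Multiset.card_add, card_content, card_content]; omega
        refine monSpan_mono ?_ (ihH L hLs hc hH hLn (hLc.symm ▸ hnd') (hHU.trans_le hLr))
        rintro m ⟨⟨hm1, hm2, hm3, hm4⟩, hm5⟩
        refine ⟨⟨hm1, ?_, ?_, hm4⟩, fun h u hu _ => hm5 h u (hbd.mono hu) (hu.trans hLr)⟩
        · rw [hm2, hLc, e2]
        · simp only [hm3, count_square_node, hLi, Kind.weight]; omega

theorem bracketMem_square_step {a b : Monomial X} (hN : a.size + b.size = N) (ha : a.Normal)
    (hb : b.Normal) (h : (a.content + b.content).Nodup) (hca : c ≤ a.root) (hcb : c ≤ b.root) :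
    BracketMem R .square c a b := by
  have hne := root_ne_of_nodup h
  rcases hca.eq_or_lt with e | hlt
  · rw [e]
    exact (squareMem_step hsmall hroot a b hN e.symm ha hb h
      (hcb.lt_of_ne (e ▸ hne))).bracketMem
  rcases hcb.eq_or_lt with e' | hlt'
  · rw [e']
    rw [add_comm] at h hN
    exact (squareMem_step hsmall hroot b a hN e'.symm hb ha h hlt).bracketMem.symm
  · exact bracketMem_of_lt_root hroot hN ha hb h hlt hlt' hca hcb _

/-- Induction on the size of `K`. If K = [H, U], mixed Jacobi trades ⟨a, [H, U]⟩ for three outer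
square brackets, already treated, and two outer angle brackets having H or U as a factor. If K = ⟨H,
U⟩ with the root of H above c, Jacobi gives ⟨⟨a, H⟩, U⟩ + ⟨H, ⟨a, U⟩⟩, again with H or U as an outer
factor. In the remaining cases the bracket is normal. -/
theorem bracketMem_angle_step (a K : Monomial X) (hN : a.size + K.size = N) (hc : a.root = c)
    (ha : a.Normal) (hK : K.Normal) (hnd : (a.content + K.content).Nodup) (hlt : c < K.root) :
    BracketMem R .angle c a K := by
  induction hs : K.size using Nat.strong_induction_on generalizing a K with
  | _ s ih =>
  subst hs
  -- Covers all outer angle brackets that arise: a left root equal to c falls under the induction on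
  -- the size of `K`, a larger one under the induction on roots.
  have angle : ∀ x y : Monomial X, x.size + y.size = N → x.Normal → y.Normal →
      (x.content + y.content).Nodup → c ≤ x.root → c < y.root → y.size < K.size →
      BracketMem R .angle c x y := by
    intro x y hxy hx hy hd hcx hcy hyK
    rcases hcx.eq_or_lt with e | hlt'
    · exact ih _ hyK x y hxy e.symm hx hy hd hcy rfl
    · exact bracketMem_of_lt_root hroot hxy hx hy hd hlt' hcy hcx hcy.le _
  have hap := a.size_pos
  rcases K with k | ⟨_ | _, H, U⟩
  · exact bracketMem_angle_of_normal ⟨ha, hK, hc.trans_lt hlt, trivial⟩ hlt.le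
  · obtain ⟨hH, hU, hHU, -⟩ := hK
    change c < H.root at hlt
    have hcU := hlt.trans hHU
    have hHp := H.size_pos
    have hUp := U.size_pos
    simp only [size] at hN angle
    have n1 : (H.content + U.content + a.content).Nodup := by rw [add_comm]; exact hnd
    have n2 : (U.content + a.content + H.content).Nodup := by rwa [add_comm, ← add_assoc]
    have n3 : (a.content + H.content + U.content).Nodup := by rwa [add_comm, ← add_assoc]
    have e1 : H.content + U.content + a.content = a.content + (node .square H U).content :=
      add_comm _ _
    have e2 : U.content + a.content + H.content = a.content + (node .square H U).content := by
      rw [← e1, add_comm, ← add_assoc]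
    have e3 : a.content + H.content + U.content = a.content + (node .square H U).content :=
      add_assoc _ _ _
    have m1 := fun k => bracketMem_small hsmall (ρ := c) (by omega) hH hU
      (Multiset.nodup_add.1 n1).1 hlt.le hcU.le k
    have m2 := fun k => bracketMem_small hsmall (ρ := c) (by omega) hU ha
      (Multiset.nodup_add.1 n2).1 hcU.le hc.ge k
    have m3 := fun k => bracketMem_small hsmall (ρ := c) (by omega) ha hH
      (Multiset.nodup_add.1 n3).1 hc.ge hlt.le k
    have square := @bracketMem_square_step R _ X _ N c hsmall hroot
    have hmix := bracket_mixed (mon R a) (mon R H) (mon R U)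
    have hcount : (node Kind.square H U).count .square = H.count .square + U.count .square + 1 :=
      count_square_node _ _ _
    rw [BracketMem, ← bracket_mon, ← neg_mem_iff]
    set i := a.count .square + (node Kind.square H U).count .square + Kind.angle.weight with hi
    simp only [Kind.weight] at hi
    have t1 := bracket_bracket_mem_right (i := i) (m1 .angle)
      (fun L hLn hLc hLs hLr =>
        (square (by omega) hLn ha (hLc ▸ n1) hLr hc.ge).symm)
        e1 (by simp only [Kind.weight]; omega)
    have t2 := bracket_bracket_mem_right (i := i) (m2 .angle)
      (fun L hLn hLc hLs hLr =>
        (square (by omega) hLn hH (hLc ▸ n2) hLr hlt.le).symm)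
        e2 (by simp only [Kind.weight]; omega)
    have t3 := bracket_bracket_mem_right (i := i) (m3 .angle)
      (fun L hLn hLc hLs hLr =>
        (square (by omega) hLn hU (hLc ▸ n3) hLr hcU.le).symm)
        e3 (by simp only [Kind.weight]; omega)
    have t4 := bracket_bracket_mem_right (i := i) (m2 .square)
      (fun L hLn hLc hLs hLr =>
        (angle L H (by omega) hLn hH (hLc ▸ n2) hLr hlt (by omega)).symm)
        e2 (by simp only [Kind.weight]; omega)
    have t5 := bracket_bracket_mem_right (i := i) (m3 .square)
      (fun L hLn hLc hLs hLr =>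
        (angle L U (by omega) hLn hU (hLc ▸ n3) hLr hcU (by omega)).symm)
        e3 (by simp only [Kind.weight]; omega)
    -- Mixed Jacobi makes the negative of the bracket equal to the sum of its five other terms.
    convert add_mem (add_mem (add_mem (add_mem t1 t2) t3) t4) t5 using 1
    rw [neg_eq_iff_add_eq_zero, ← hmix]
    abel
  · obtain ⟨hH, hU, hHU, hbd⟩ := hK
    change c < U.root at hlt
    by_cases hHc : H.root ≤ c
    · exact bracketMem_angle_of_normal ⟨ha, ⟨hH, hU, hHU, hbd⟩, hc.trans_lt hlt, hc ▸ hHc⟩ hlt.le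
    rw [not_le] at hHc
    have hHp := H.size_pos
    have hUp := U.size_pos
    simp only [size] at hN angle
    have n1 : (a.content + H.content + U.content).Nodup := by rw [add_assoc]; exact hnd
    have n2 : (a.content + U.content + H.content).Nodup := by rwa [add_right_comm]
    rw [BracketMem, ← bracket_mon, bracket_bracket_right]
    refine add_mem (bracket_bracket_mem_left (ρ := c)
      (bracketMem_small hsmall (by omega) ha hH (Multiset.nodup_add.1 n1).1 hc.ge hHc.le _)
      (fun L hLn hLc hLs hLr => angle L U (by omega) hLn hU (hLc ▸ n1) hLr hlt (by omega)) ?_ ?_)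
      (bracket_bracket_mem_right (ρ := c)
      (bracketMem_small hsmall (by omega) ha hU (Multiset.nodup_add.1 n2).1 hc.ge hlt.le _)
      (fun L hLn hLc hLs hLr => (angle L H (by omega) hLn hH (hLc ▸ n2) hLr hHc (by omega)).symm)
      ?_ ?_)
    · exact add_assoc _ _ _
    · simp only [count_square_node, Kind.weight]; omega
    · rw [add_right_comm]; exact add_assoc _ _ _
    · simp only [count_square_node, Kind.weight]; omega

end Step

theorem straightens [WellFoundedGT X] (a b : Monomial X) : Straightens R a b := by
  induction hN : a.size + b.size using Nat.strong_induction_on generalizing a b with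
  | _ N ihN =>
  induction hc : a.root using WellFoundedGT.induction generalizing a b with
  | _ c ihc =>
  have hsmall : ∀ a b : Monomial X, a.size + b.size < N → Straightens R a b :=
    fun a b h => ihN _ h a b rfl
  have hroot : ∀ a b : Monomial X, a.size + b.size = N → c < a.root → Straightens R a b :=
    fun a b h h' => ihc _ h' a b h rfl
  intro ha hb hnd hlt
  exact ⟨squareMem_step hsmall hroot a b hN hc ha hb hnd (hc ▸ hlt),
    hc ▸ bracketMem_angle_step hsmall hroot a b hN hc ha hb hnd (hc ▸ hlt)⟩

/-- Every monomial without repeated letters is a combination of normal monomials with the same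
letters and the same number of square brackets. -/
theorem mon_mem_monSpan_normal [WellFoundedGT X] (m : Monomial X) (h : m.content.Nodup) :
    mon R m ∈ monSpan R fun m' => m'.Normal ∧ m'.content = m.content ∧
      m'.count .square = m.count .square := by
  induction m with
  | letter x => exact mon_mem_monSpan ⟨trivial, rfl, rfl⟩
  | node c a b iha ihb =>
    have hab := Multiset.nodup_add.1 h
    rw [← bracket_mon]
    refine bracket_mem_left (iha hab.1) fun a' ⟨ha1, ha2, ha3⟩ => ?_
    refine bracket_mem_right (ihb hab.2.1) fun b' ⟨hb1, hb2, hb3⟩ => ?_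
    refine monSpan_mono ?_ (bracketMem_of_straightens (ρ := min a'.root b'.root) ha1 hb1
      (by rw [ha2, hb2]; exact h) (min_le_left _ _) (min_le_right _ _)
      (fun _ => straightens a' b') (fun _ => straightens b' a') c)
    rintro m ⟨hm1, hm2, hm3, -⟩
    exact ⟨hm1, by rw [hm2, ha2, hb2, content], by rw [hm3, ha3, hb3, count_square_node]⟩

end Straightening

/-! ### The compatible Lie brackets on trees -/

/-- A root, a multiset of vertices and a multiset of edges `(parent, child)`. -/
abbrev TreeData (X : Type) := X × Multiset X × Multiset (X × X)

namespace TreeData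

/-- Attach the root of `U` to the vertex `x` of `T`. -/
def graft {X : Type} (x : X) (T U : TreeData X) : TreeData X :=
  (T.1, T.2.1 + U.2.1, (x, U.1) ::ₘ (T.2.2 + U.2.2))

theorem graft_graft {X : Type} (x y : X) (T U V : TreeData X) :
    graft y (graft x T U) V = graft x T (graft y U V) := by
  simp only [graft, Multiset.add_cons, Multiset.cons_add, add_assoc]
  rw [Multiset.cons_swap]

theorem graft_graft_comm {X : Type} (x y : X) (T U V : TreeData X) :
    graft y (graft x T U) V = graft x (graft y T V) U := by
  simp only [graft, Multiset.cons_add]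
  rw [Multiset.cons_swap, add_right_comm T.2.1, add_right_comm T.2.2]

end TreeData

open TreeData

section Model

variable {R : Type*} [CommRing R] {X : Type}

/-- The product of tree data: graft the second factor at all vertices `x` of the first factor,
with weights depending on `x` and on the root of the second factor. -/
noncomputable def graftProd (w : X → X → R) :
    (TreeData X →₀ R) →ₗ[R] (TreeData X →₀ R) →ₗ[R] (TreeData X →₀ R) :=
  Finsupp.linearCombination R fun T => Finsupp.linearCombination R fun U =>
    (T.2.1.map fun x => Finsupp.single (graft x T U) (w x U.1)).sum

theorem graftProd_single (w : X → X → R) (T U : TreeData X) (a b : R) :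
    graftProd w (Finsupp.single T a) (Finsupp.single U b) =
      (T.2.1.map fun x => Finsupp.single (graft x T U) (a * b * w x U.1)).sum := by
  simp only [graftProd, Finsupp.linearCombination_single, LinearMap.smul_apply,
    Multiset.smul_sum, Multiset.map_map, Function.comp_def, Finsupp.smul_single, smul_eq_mul,
    mul_assoc]

theorem map_multiset_sum_map {M N ι : Type*} [AddCommMonoid M] [AddCommMonoid N] [Module R M]
    [Module R N] (f : M →ₗ[R] N) (s : Multiset ι) (g : ι → M) :
    f (s.map g).sum = (s.map fun i => f (g i)).sum := by
  rw [map_multiset_sum, Multiset.map_map]; rfl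

theorem multiset_sum_map_apply {M N ι : Type*} [AddCommMonoid M] [AddCommMonoid N] [Module R M]
    [Module R N] (s : Multiset ι) (g : ι → M →ₗ[R] N) (x : M) :
    (s.map g).sum x = (s.map fun i => g i x).sum := by
  induction s using Multiset.induction_on with
  | empty => simp
  | cons a s ih => simp [ih]

/-- After U is grafted on T, the tree V lands either on a vertex of U, which gives the nested
product, or on a vertex of T, which gives the double sum. -/
theorem graftProd_graftProd_single (w w' : X → X → R) (T U V : TreeData X) (a b c : R) :
    graftProd w (graftProd w' (Finsupp.single T a) (Finsupp.single U b)) (Finsupp.single V c) =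
      graftProd w' (Finsupp.single T a) (graftProd w (Finsupp.single U b) (Finsupp.single V c)) +
      (T.2.1.map fun x => (T.2.1.map fun y => Finsupp.single (graft y (graft x T U) V)
        (a * b * c * w' x U.1 * w y V.1)).sum).sum := by
  rw [graftProd_single, graftProd_single]
  simp only [map_multiset_sum_map, multiset_sum_map_apply, graftProd_single]
  have : ∀ x : X, (graft x T U).2.1 = U.2.1 + T.2.1 := fun x => add_comm _ _
  simp only [this, Multiset.map_add, Multiset.sum_add, Multiset.sum_map_add]
  congr 1
  · rw [Multiset.sum_map_sum_map]
    refine congrArg _ (Multiset.map_congr rfl fun y _ => congrArg _ (Multiset.map_congr rfl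
      fun x _ => ?_))
    rw [graft_graft]
    congr 1
    change _ = a * (b * c * w y V.1) * w' x U.1
    ring
  · refine congrArg _ (Multiset.map_congr rfl fun y _ => congrArg _ (Multiset.map_congr rfl
      fun x _ => ?_))
    congr 1
    ring

/-- The two-weight version of the pre-Lie identity. -/
theorem graftProd_preLie (w w' : X → X → R) (x y z : TreeData X →₀ R) :
    graftProd w (graftProd w' x y) z - graftProd w' x (graftProd w y z) =
      graftProd w' (graftProd w x z) y - graftProd w x (graftProd w' z y) := by
  induction x using Finsupp.induction_linear with
  | zero => simp
  | add f g hf hg =>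
    simp only [map_add, LinearMap.add_apply, add_sub_add_comm, hf, hg]
  | single T a =>
  induction y using Finsupp.induction_linear with
  | zero => simp
  | add f g hf hg =>
    simp only [map_add, LinearMap.add_apply, add_sub_add_comm, hf, hg]
  | single U b =>
  induction z using Finsupp.induction_linear with
  | zero => simp
  | add f g hf hg =>
    simp only [map_add, LinearMap.add_apply, add_sub_add_comm, hf, hg]
  | single V c =>
  -- Each associator is the double sum of graftings of both trees on T, which is unchanged when (w',
  -- U) and (w, V) are exchanged.
  rw [graftProd_graftProd_single, graftProd_graftProd_single, add_sub_cancel_left,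
    add_sub_cancel_left, Multiset.sum_map_sum_map]
  refine congrArg _ (Multiset.map_congr rfl fun y _ => congrArg _ (Multiset.map_congr rfl
    fun x _ => ?_))
  rw [graft_graft_comm]
  congr 1
  ring

variable [LinearOrder X]

variable (R) in
/-- The weights of the two brackets: `[·,·]` creates increasing edges and `⟨·,·⟩` decreasing
ones. -/
def edgeWeight : Kind → X → X → R
  | .square => fun x y => if x < y then 1 else 0
  | .angle => fun x y => if y < x then 1 else 0

/-- The two compatible Lie brackets on the span of tree data. -/
noncomputable def treeBracket (c : Kind) :
    (TreeData X →₀ R) →ₗ[R] (TreeData X →₀ R) →ₗ[R] (TreeData X →₀ R) :=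
  LinearMap.mk₂ R (fun x y =>
    graftProd (X := X) (edgeWeight R c) x y - graftProd (X := X) (edgeWeight R c) y x)
    (fun x y z => by simp only [map_add, LinearMap.add_apply, add_sub_add_comm])
    (fun r x y => by simp only [map_smul, LinearMap.smul_apply, smul_sub])
    (fun x y z => by simp only [map_add, LinearMap.add_apply, add_sub_add_comm])
    (fun r x y => by simp only [map_smul, LinearMap.smul_apply, smul_sub])

theorem treeBracket_apply (c : Kind) (x y : TreeData X →₀ R) :
    treeBracket c x y =
      graftProd (edgeWeight (X := X) R c) x y - graftProd (edgeWeight (X := X) R c) y x := rfl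

/-- The two-weight pre-Lie identity, applied to all six orderings of the arguments, makes the terms
cancel; the particular form of the weights plays no role. -/
theorem treeBracket_mixed (c d : Kind) (x y z : TreeData X →₀ R) :
    treeBracket c x (treeBracket d y z) + treeBracket c y (treeBracket d z x)
      + treeBracket c z (treeBracket d x y) + treeBracket d x (treeBracket c y z)
      + treeBracket d y (treeBracket c z x) + treeBracket d z (treeBracket c x y) = 0 := by
  simp only [treeBracket_apply, map_sub]
  have h := graftProd_preLie (edgeWeight (X := X) R c) (edgeWeight (X := X) R d)
  have h1 := eq_add_of_sub_eq (h x y z)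
  have h2 := eq_add_of_sub_eq (h y z x)
  have h3 := eq_add_of_sub_eq (h z x y)
  have h4 := eq_add_of_sub_eq (h x z y)
  have h5 := eq_add_of_sub_eq (h y x z)
  have h6 := eq_add_of_sub_eq (h z y x)
  rw [h1, h2, h3, h4, h5, h6]
  abel

theorem treeBracket_jacobi (c : Kind) (x y z : TreeData X →₀ R) :
    treeBracket c x (treeBracket c y z) + treeBracket c y (treeBracket c z x)
      + treeBracket c z (treeBracket c x y) = 0 := by
  simp only [treeBracket_apply, map_sub]
  have h := graftProd_preLie (edgeWeight (X := X) R c) (edgeWeight (X := X) R c)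
  have h1 := eq_add_of_sub_eq (h x y z)
  have h2 := eq_add_of_sub_eq (h y z x)
  have h3 := eq_add_of_sub_eq (h z x y)
  rw [h1, h2, h3]
  abel

/-! ### The homomorphism from the free algebra to the algebra of trees -/

/-- The tree data of a letter. -/
def TreeData.leaf {X : Type} (x : X) : TreeData X := (x, {x}, 0)

variable (R) in
/-- The value of a monomial in the algebra of tree data. -/
noncomputable def Monomial.treeValue : Monomial X → (TreeData X →₀ R)
  | letter x => Finsupp.single (TreeData.leaf x) 1
  | node c a b => treeBracket c a.treeValue b.treeValue

variable (R X) in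
/-- The linear extension of `Monomial.treeValue`. -/
noncomputable def magmaticTreeValue : Magmatic R X →ₗ[R] (TreeData X →₀ R) :=
  Finsupp.linearCombination R (Monomial.treeValue R)

theorem magmaticTreeValue_br (c : Kind) (u v : Magmatic R X) :
    magmaticTreeValue R X (Magmatic.br R c u v) =
      treeBracket c (magmaticTreeValue R X u) (magmaticTreeValue R X v) := by
  induction u using Finsupp.induction_linear with
  | zero => simp
  | add f g hf hg => simp only [map_add, LinearMap.add_apply, hf, hg]
  | single m a =>
  induction v using Finsupp.induction_linear with
  | zero => simp
  | add f g hf hg => simp only [map_add, hf, hg]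
  | single m' b =>
  rw [← Finsupp.smul_single_one m a, ← Finsupp.smul_single_one m' b]
  simp only [map_smul, LinearMap.smul_apply, Magmatic.br_single]
  simp only [magmaticTreeValue, Finsupp.linearCombination_single, one_smul, Monomial.treeValue]

theorem magmaticTreeValue_relator {f : Magmatic R X} (h : Relator R X f) :
    magmaticTreeValue R X f = 0 := by
  induction h with
  | symm c x y => simp [magmaticTreeValue_br, treeBracket_apply]
  | jacobi c x y z => simpa [magmaticTreeValue_br] using treeBracket_jacobi c _ _ _
  | mixed x y z => simpa [magmaticTreeValue_br] using treeBracket_mixed .square .angle _ _ _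
  | left c u f _ ih => rw [magmaticTreeValue_br, ih, map_zero]
  | right c u f _ ih => rw [magmaticTreeValue_br, ih, map_zero, LinearMap.zero_apply]

variable (R X) in
/-- The homomorphism from the free algebra to the algebra of tree data. -/
noncomputable def treeHom : FreeLie2 R X →ₗ[R] (TreeData X →₀ R) :=
  (relations R X).liftQ (magmaticTreeValue R X)
    (Submodule.span_le.2 fun _ h => magmaticTreeValue_relator h)

theorem treeHom_mon (m : Monomial X) : treeHom R X (mon R m) = m.treeValue R := by
  simp [treeHom, mon, magmaticTreeValue]

theorem treeHom_bracket (c : Kind) (u v : FreeLie2 R X) :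
    treeHom R X (bracket R c u v) = treeBracket c (treeHom R X u) (treeHom R X v) := by
  obtain ⟨u, rfl⟩ := Submodule.mkQ_surjective _ u
  obtain ⟨v, rfl⟩ := Submodule.mkQ_surjective _ v
  exact magmaticTreeValue_br c u v

end Model

/-! ### Every rooted tree is in the image of the free algebra -/

namespace TreeData

/-- The tree data obtained from letters by grafting at roots. -/
inductive IsRootedTree {X : Type} : TreeData X → Prop
  | leaf (x : X) : IsRootedTree (TreeData.leaf x)
  | graft (T U : TreeData X) : IsRootedTree T → IsRootedTree U → IsRootedTree (graft T.1 T U)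

theorem IsRootedTree.root_cons_map_snd {X : Type} {T : TreeData X} (h : T.IsRootedTree) :
    T.1 ::ₘ T.2.2.map Prod.snd = T.2.1 := by
  induction h with
  | leaf x => rfl
  | graft T U _ _ ihT ihU =>
    simp only [TreeData.graft, Multiset.map_cons, Multiset.map_add, ← ihT, ← ihU,
      Multiset.cons_add, Multiset.add_cons]
    rw [Multiset.cons_swap]

theorem IsRootedTree.root_mem {X : Type} {T : TreeData X} (h : T.IsRootedTree) : T.1 ∈ T.2.1 :=
  h.root_cons_map_snd ▸ Multiset.mem_cons_self _ _

theorem IsRootedTree.snd_mem {X : Type} {T : TreeData X} (h : T.IsRootedTree) {x y : X}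
    (hxy : (x, y) ∈ T.2.2) : y ∈ T.2.1 :=
  h.root_cons_map_snd ▸ Multiset.mem_cons_of_mem (Multiset.mem_map_of_mem Prod.snd hxy)

theorem IsRootedTree.not_mem_edges_root {X : Type} {T : TreeData X} (h : T.IsRootedTree)
    (hn : T.2.1.Nodup) (x : X) : (x, T.1) ∉ T.2.2 := fun hx => by
  rw [← h.root_cons_map_snd, Multiset.nodup_cons] at hn
  exact hn.1 (Multiset.mem_map_of_mem Prod.snd hx)

/-- A grafting at a non-root vertex can be pushed, by `graft_graft` and `graft_graft_comm`, into the
factor containing that vertex, until it takes place at a root. -/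
theorem IsRootedTree.graft_of_mem {X : Type} {T U : TreeData X} (hT : T.IsRootedTree)
    (hU : U.IsRootedTree) {x : X} (hx : x ∈ T.2.1) :
    IsRootedTree (TreeData.graft x T U) := by
  induction hT with
  | leaf y =>
    rw [TreeData.leaf, Multiset.mem_singleton] at hx
    subst hx
    exact .graft (TreeData.leaf x) U (.leaf x) hU
  | graft T V hT hV ihT ihV =>
    rcases Multiset.mem_add.1 hx with hx | hx
    · rw [graft_graft_comm]
      exact .graft (TreeData.graft x T U) V (ihT hx) hV
    · rw [graft_graft]
      exact .graft T (TreeData.graft x V U) hT (ihV hx)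

variable {n : ℕ}

open Classical in
/-- The state of a vertex: `1` for the root, `0` if its parent is larger, and `2` otherwise. -/
noncomputable def state (T : TreeData (Fin n)) (v : Fin n) : ℕ :=
  if v = T.1 then 1 else if ∃ x, (x, v) ∈ T.2.2 ∧ v < x then 0 else 2

/-- The potential of a tree. -/
noncomputable def potential (T : TreeData (Fin n)) : ℕ :=
  ∑ v, T.state v * 3 ^ (v : ℕ)

/-- The number of children of the root. -/
def rootDegree (T : TreeData (Fin n)) : ℕ := T.2.2.countP fun e => e.1 = T.1

theorem state_le_two (T : TreeData (Fin n)) (v : Fin n) : T.state v ≤ 2 := by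
  unfold state; split_ifs <;> decide

theorem state_root (T : TreeData (Fin n)) : T.state T.1 = 1 := if_pos rfl

theorem state_congr {T U : TreeData (Fin n)} {v : Fin n} (hr : v = T.1 ↔ v = U.1)
    (hE : (∃ x, (x, v) ∈ T.2.2 ∧ v < x) ↔ ∃ x, (x, v) ∈ U.2.2 ∧ v < x) :
    T.state v = U.state v := by
  unfold state
  simp only [hr, hE]

theorem exists_mem_graft {T U : TreeData (Fin n)} {x v : Fin n} :
    (∃ y, (y, v) ∈ (TreeData.graft x T U).2.2 ∧ v < y) ↔
      (v = U.1 ∧ v < x) ∨ ∃ y, (y, v) ∈ T.2.2 + U.2.2 ∧ v < y := by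
  simp only [TreeData.graft, Multiset.mem_cons, Prod.mk.injEq]
  constructor
  · rintro ⟨y, ⟨rfl, h⟩ | h, hv⟩
    · exact .inl ⟨h, hv⟩
    · exact .inr ⟨y, h, hv⟩
  · rintro (⟨h, hv⟩ | ⟨y, h, hv⟩)
    · exact ⟨x, .inl ⟨rfl, h⟩, hv⟩
    · exact ⟨y, .inr h, hv⟩

theorem potential_graft_congr {T U : TreeData (Fin n)} {x y : Fin n}
    (h : U.1 < x ↔ U.1 < y) :
    (TreeData.graft x T U).potential = (TreeData.graft y T U).potential := by
  refine Finset.sum_congr rfl fun v _ => ?_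
  have hv : v = U.1 ∧ v < x ↔ v = U.1 ∧ v < y := and_congr_right fun e => e ▸ h
  have : (TreeData.graft x T U).state v = (TreeData.graft y T U).state v :=
    state_congr Iff.rfl (by rw [exists_mem_graft, exists_mem_graft, hv])
  rw [this]

theorem rootDegree_graft_lt {T U : TreeData (Fin n)} {x : Fin n} (h : x ≠ T.1) :
    (TreeData.graft x T U).rootDegree < (TreeData.graft T.1 T U).rootDegree := by
  have e1 : (TreeData.graft x T U).rootDegree =
      (T.2.2 + U.2.2).countP fun e => e.1 = T.1 := Multiset.countP_cons_of_neg _ h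
  have e2 : (TreeData.graft T.1 T U).rootDegree =
      ((T.2.2 + U.2.2).countP fun e => e.1 = T.1) + 1 := Multiset.countP_cons_of_pos _ rfl
  omega

theorem sum_lt_sum_of_eq_off_pair {f g w : Fin n → ℕ} {r c : Fin n} (hrc : r ≠ c)
    (h : ∀ v, v ≠ r → v ≠ c → f v = g v)
    (hlt : f r * w r + f c * w c < g r * w r + g c * w c) :
    ∑ v, f v * w v < ∑ v, g v * w v := by
  have hc : c ∈ Finset.univ.erase r := Finset.mem_erase.2 ⟨hrc.symm, Finset.mem_univ c⟩
  rw [← Finset.add_sum_erase _ _ (Finset.mem_univ r), ← Finset.add_sum_erase _ _ hc,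
    ← Finset.add_sum_erase _ (fun v => g v * w v) (Finset.mem_univ r),
    ← Finset.add_sum_erase _ (fun v => g v * w v) hc, ← add_assoc, ← add_assoc]
  refine add_lt_add_of_lt_of_le hlt (Finset.sum_le_sum fun v hv => ?_)
  rw [Finset.mem_erase, Finset.mem_erase] at hv
  rw [h v hv.2.1 hv.1]

theorem state_graft_swap {T U : TreeData (Fin n)} {x v : Fin n} (hT : v ≠ T.1) (hU : v ≠ U.1) :
    (TreeData.graft x U T).state v = (TreeData.graft T.1 T U).state v := by
  refine state_congr ⟨fun h => absurd h hU, fun h => absurd h hT⟩ ?_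
  rw [exists_mem_graft, exists_mem_graft, add_comm U.2.2]
  simp [hT, hU]

/-- Making the root of U the new root changes only the digits at the two roots, and the digit of the
larger one drops: from 2 to 1 if it is the root of U, from 1 to 0 if it is the root of T. In both
cases the digit of the smaller one rises by at most 1. -/
theorem potential_graft_swap_lt {T U : TreeData (Fin n)} {x : Fin n} (hne : T.1 ≠ U.1)
    (hU : ∀ y, (y, U.1) ∉ T.2.2 + U.2.2)
    (h : (T.1 < U.1 ∧ x < T.1) ∨ (U.1 < T.1 ∧ T.1 < x)) :
    (TreeData.graft x U T).potential < (TreeData.graft T.1 T U).potential := by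
  refine sum_lt_sum_of_eq_off_pair hne (fun v h1 h2 => state_graft_swap h1 h2) ?_
  rw [show (TreeData.graft x U T).state U.1 = 1 from state_root _,
    show (TreeData.graft T.1 T U).state T.1 = 1 from state_root _]
  rcases h with ⟨h1, h2⟩ | ⟨h1, h2⟩
  · have e : (TreeData.graft T.1 T U).state U.1 = 2 := by
      unfold state
      rw [if_neg (show U.1 ≠ (TreeData.graft T.1 T U).1 from hne.symm), if_neg]
      rw [exists_mem_graft]
      rintro (⟨-, h⟩ | ⟨y, hy, -⟩)
      · exact h.not_gt h1
      · exact hU y hy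
    rw [e]
    have := Nat.mul_le_mul_right (3 ^ (T.1 : ℕ)) ((TreeData.graft x U T).state_le_two T.1)
    have := Nat.pow_lt_pow_right (a := 3) (by decide) (Fin.lt_def.1 h1)
    omega
  · have e : (TreeData.graft x U T).state T.1 = 0 := by
      unfold state
      rw [if_neg (show T.1 ≠ (TreeData.graft x U T).1 from hne), if_pos]
      rw [exists_mem_graft]
      exact .inl ⟨rfl, h2⟩
    rw [e]
    have := Nat.pow_lt_pow_right (a := 3) (by decide) (Fin.lt_def.1 h1)
    omega

end TreeData

section Surjectivity

variable {R : Type*} [CommRing R] {n : ℕ}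

theorem graftProd_single_mem {X : Type} {w : X → X → R} {T U : TreeData X} {s : Multiset X}
    {W : Submodule R (TreeData X →₀ R)}
    (h : ∀ x ∈ s, w x U.1 ≠ 0 → Finsupp.single (graft x T U) 1 ∈ W) :
    (s.map fun x => Finsupp.single (graft x T U) (1 * 1 * w x U.1)).sum ∈ W := by
  refine multiset_sum_mem _ fun v hv => ?_
  obtain ⟨x, hx, rfl⟩ := Multiset.mem_map.1 hv
  by_cases h0 : w x U.1 = 0
  · rw [h0, mul_zero, Finsupp.single_zero]; exact zero_mem _
  · rw [← Finsupp.smul_single_one]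
    exact W.smul_mem _ (h x hx h0)

/-- The grafting at the root is one term, with coefficient 1, of the bracket of T and U; it lies in
`W` as soon as the bracket and all other terms do. -/
theorem single_graft_mem {T U : TreeData (Fin n)} {W : Submodule R (TreeData (Fin n) →₀ R)}
    {c : Kind} (hT : T.1 ∈ T.2.1) (hn : T.2.1.Nodup) (hw : edgeWeight R c T.1 U.1 = 1)
    (hb : treeBracket c (Finsupp.single T 1) (Finsupp.single U 1) ∈ W)
    (h1 : ∀ x ∈ T.2.1, x ≠ T.1 → edgeWeight R c x U.1 ≠ 0 →
      Finsupp.single (graft x T U) 1 ∈ W)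
    (h2 : ∀ x ∈ U.2.1, edgeWeight R c x T.1 ≠ 0 → Finsupp.single (graft x U T) 1 ∈ W) :
    Finsupp.single (graft T.1 T U) 1 ∈ W := by
  rw [treeBracket_apply, graftProd_single, graftProd_single, ← Multiset.cons_erase hT,
    Multiset.map_cons, Multiset.sum_cons, hw, mul_one (1 * 1), mul_one (1 : R)] at hb
  have m2 := graftProd_single_mem (w := edgeWeight R c) h2
  have m1 := graftProd_single_mem (w := edgeWeight R c) (T := T) (U := U)
    (s := T.2.1.erase T.1) (W := W) fun x hx =>
      h1 x (Multiset.mem_of_mem_erase hx) ((Multiset.Nodup.mem_erase_iff hn).1 hx).1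
  rw [mul_one (1 : R)] at m1 m2
  have := sub_mem (add_mem hb m2) m1
  rwa [sub_add_cancel, add_sub_cancel_right] at this

variable (R) in
/-- The image of the span of the monomials with given letters in the algebra of tree data. -/
noncomputable def treeImage (S : Multiset (Fin n)) : Submodule R (TreeData (Fin n) →₀ R) :=
  (monSpan R fun m => m.content = S).map (treeHom R (Fin n))

theorem treeBracket_mem_treeImage (c : Kind) {S S' : Multiset (Fin n)}
    {x y : TreeData (Fin n) →₀ R} (hx : x ∈ treeImage R S) (hy : y ∈ treeImage R S') :
    treeBracket c x y ∈ treeImage R (S + S') := by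
  obtain ⟨u, hu, rfl⟩ := hx
  obtain ⟨v, hv, rfl⟩ := hy
  rw [← treeHom_bracket]
  refine Submodule.mem_map_of_mem (bracket_mem_left hu fun a ha => bracket_mem_right hv fun b hb =>
    ?_)
  rw [bracket_mon]
  exact mon_mem_monSpan (by rw [content, ha, hb])

/-- Lexicographic induction on number of vertices, potential and degree of the root. A tree with
more than one vertex is U grafted at the root of T, and the bracket of the color of this edge lies
in the image by the induction on vertices. Its other terms graft U elsewhere on T (same potential,
smaller root degree) or T on U (smaller potential). -/
theorem single_mem_treeImage {T : TreeData (Fin n)} (hT : T.IsRootedTree) (hn : T.2.1.Nodup) :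
    Finsupp.single T 1 ∈ treeImage R T.2.1 := by
  induction hk : T.2.1.card using Nat.strong_induction_on generalizing T with
  | _ k ihk =>
  induction hp : T.potential using Nat.strong_induction_on generalizing T with
  | _ p ihp =>
  induction hd : T.rootDegree using Nat.strong_induction_on generalizing T with
  | _ d ihd =>
  cases hT with
  | leaf x =>
    exact ⟨mon R (letter x), mon_mem_monSpan rfl, treeHom_mon _⟩
  | graft T U hT hU =>
    have hn' : (T.2.1 + U.2.1).Nodup := hn
    have hk' : T.2.1.card + U.2.1.card = k := by rw [← hk]; exact (Multiset.card_add _ _).symm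
    obtain ⟨hnT, hnU, hdis⟩ := Multiset.nodup_add.1 hn'
    rw [Multiset.disjoint_left] at hdis
    have hTp := Multiset.card_pos_iff_exists_mem.2 ⟨_, hT.root_mem⟩
    have hUp := Multiset.card_pos_iff_exists_mem.2 ⟨_, hU.root_mem⟩
    have hne : T.1 ≠ U.1 := fun e => hdis hT.root_mem (e ▸ hU.root_mem)
    have hUE : ∀ y, (y, U.1) ∉ T.2.2 + U.2.2 := fun y hy => by
      rcases Multiset.mem_add.1 hy with hy | hy
      · exact hdis (hT.snd_mem hy) hU.root_mem
      · exact hU.not_mem_edges_root hnU y hy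
    have hb := fun c => treeBracket_mem_treeImage c (ihk _ (by omega) hT hnT rfl)
      (ihk _ (by omega) hU hnU rfl) (R := R)
    have s1 : ∀ x ∈ T.2.1, x ≠ T.1 → (U.1 < x ↔ U.1 < T.1) →
        Finsupp.single (TreeData.graft x T U) 1 ∈ treeImage R (T.2.1 + U.2.1) := by
      intro x hx hxr hxU
      have h1 := (rootDegree_graft_lt (U := U) hxr).trans_eq hd
      have h2 := (potential_graft_congr hxU).trans hp
      have h3 : (TreeData.graft x T U).2.1.card = k := hk
      exact ihd _ h1 (T := TreeData.graft x T U) (hT.graft_of_mem hU hx) hn h3 h2 rfl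
    have s2 : ∀ x ∈ U.2.1, (T.1 < U.1 ∧ x < T.1) ∨ (U.1 < T.1 ∧ T.1 < x) →
        Finsupp.single (TreeData.graft x U T) 1 ∈ treeImage R (T.2.1 + U.2.1) := by
      intro x hx h
      have := ihp _ ((potential_graft_swap_lt hne hUE h).trans_eq hp) (hU.graft_of_mem hT hx)
        (show (U.2.1 + T.2.1).Nodup by rwa [add_comm])
        (by rw [← hk]; exact congrArg _ (add_comm _ _))
        rfl
      rwa [show (TreeData.graft x U T).2.1 = T.2.1 + U.2.1 from add_comm _ _] at this
    rcases lt_or_gt_of_ne hne with hlt | hlt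
    · refine single_graft_mem (c := .square) hT.root_mem hnT (if_pos hlt) (hb .square)
        (fun x hx hxr hw => s1 x hx hxr ?_) (fun x hx hw => s2 x hx (.inl ⟨hlt, ?_⟩))
      -- A nonzero weight forces the new edge to have the same color as the edge at the root, so the
      -- potential does not change.
      · have : x < U.1 := by by_contra hc; exact hw (if_neg hc)
        exact ⟨fun h => absurd h this.not_gt, fun h => absurd h hlt.not_gt⟩
      · by_contra hc; exact hw (if_neg hc)
    · refine single_graft_mem (c := .angle) hT.root_mem hnT (if_pos hlt) (hb .angle)
        (fun x hx hxr hw => s1 x hx hxr ?_) (fun x hx hw => s2 x hx (.inr ⟨hlt, ?_⟩))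
      · have : U.1 < x := by by_contra hc; exact hw (if_neg hc)
        exact ⟨fun _ => hlt, fun _ => this⟩
      · by_contra hc; exact hw (if_neg hc)

end Surjectivity

/-! ### Tree data of monomials -/

namespace Monomial

/-- The tree data of the rooted tree encoded by a monomial. -/
def treeData {X : Type} (m : Monomial X) : TreeData X := (m.root, m.content, m.edges)

theorem isRootedTree_treeData {X : Type} (m : Monomial X) : m.treeData.IsRootedTree := by
  induction m with
  | letter x => exact .leaf x
  | node k a b iha ihb =>
    cases k with
    | square => exact .graft _ _ iha ihb
    | angle =>
      have h := TreeData.IsRootedTree.graft _ _ ihb iha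
      simp only [TreeData.graft, treeData] at h
      rwa [add_comm b.content, add_comm b.edges] at h

theorem nodup_of_node {X : Type} {k : Kind} {a b : Monomial X}
    (h : (node k a b).content.Nodup) :
    a.content.Nodup ∧ b.content.Nodup ∧ ∀ x ∈ a.content, x ∉ b.content := by
  have h' := Multiset.nodup_add.1 h
  exact ⟨h'.1, h'.2.1, fun x hx hx' => Multiset.disjoint_left.1 h'.2.2 hx hx'⟩

theorem mem_content_of_mem_edges {X : Type} {m : Monomial X} {x y : X} (h : (x, y) ∈ m.edges) :
    x ∈ m.content ∧ y ∈ m.content := by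
  induction m with
  | letter x => simp [edges] at h
  | node k a b iha ihb =>
    have hab : (x, y) ∈ a.edges + b.edges → x ∈ a.content + b.content ∧ y ∈ a.content + b.content :=
      fun h => by
        rw [Multiset.mem_add, Multiset.mem_add]
        rcases Multiset.mem_add.1 h with h | h
        · exact ⟨.inl (iha h).1, .inl (iha h).2⟩
        · exact ⟨.inr (ihb h).1, .inr (ihb h).2⟩
    have ha : a.root ∈ (node k a b).content := Multiset.mem_add.2 (.inl a.root_mem_content)
    have hb : b.root ∈ (node k a b).content := Multiset.mem_add.2 (.inr b.root_mem_content)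
    cases k with
    | square =>
      rcases Multiset.mem_cons.1 h with h | h
      · obtain ⟨rfl, rfl⟩ := Prod.mk.injEq _ _ _ _ ▸ h
        exact ⟨ha, hb⟩
      · exact hab h
    | angle =>
      rcases Multiset.mem_cons.1 h with h | h
      · obtain ⟨rfl, rfl⟩ := Prod.mk.injEq _ _ _ _ ▸ h
        exact ⟨hb, ha⟩
      · exact hab h

theorem card_edges {X : Type} (m : Monomial X) : m.edges.card + 1 = m.content.card := by
  have h := congrArg Multiset.card m.isRootedTree_treeData.root_cons_map_snd
  rwa [Multiset.card_cons, Multiset.card_map] at h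

theorem nodup_map_snd_edges {X : Type} {m : Monomial X} (h : m.content.Nodup) :
    (m.edges.map Prod.snd).Nodup := by
  have e : m.root ::ₘ m.edges.map Prod.snd = m.content := m.isRootedTree_treeData.root_cons_map_snd
  rw [← e] at h
  exact (Multiset.nodup_cons.1 h).2

theorem parent_unique {X : Type} {m : Monomial X} (h : m.content.Nodup) {x y z : X}
    (hx : (x, z) ∈ m.edges) (hy : (y, z) ∈ m.edges) : x = y :=
  congrArg Prod.fst (Multiset.inj_on_of_nodup_map (nodup_map_snd_edges h) _ hx _ hy rfl)

theorem not_mem_edges_root {X : Type} {m : Monomial X} (h : m.content.Nodup) (x : X) :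
    (x, m.root) ∉ m.edges :=
  m.isRootedTree_treeData.not_mem_edges_root h x

section Bounds

variable {X : Type} [LinearOrder X]

/-- In nested angle brackets the children of the root decrease from the outside inwards, so a bound
on the outermost one bounds them all. -/
theorem child_le_of_angleBound {m : Monomial X} (hm : m.Normal) (hn : m.content.Nodup) {u y : X}
    (hu : m.AngleBound u) (hy : (m.root, y) ∈ m.edges) : y ≤ u := by
  induction m generalizing u with
  | letter x => simp [edges] at hy
  | node k a b _ ihb =>
    cases k with
    | square => exact hu.elim
    | angle =>
      obtain ⟨-, hb, hab, hbd⟩ := hm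
      obtain ⟨hna, hnb, hdis⟩ := nodup_of_node hn
      rcases Multiset.mem_cons.1 hy with h | h
      · obtain ⟨-, rfl⟩ := Prod.mk.injEq _ _ _ _ ▸ h
        exact hu
      rcases Multiset.mem_add.1 h with h | h
      · exact (hdis _ (mem_content_of_mem_edges h).1 b.root_mem_content).elim
      · exact (ihb hb hnb hbd h).trans hu

/-- In nested square brackets the children of the root increase from the outside inwards; once an
angle bracket is reached, no child larger than the root is left. -/
theorem le_child_of_squareBound {m : Monomial X} (hm : m.Normal) (hn : m.content.Nodup) {u y : X}
    (hu : m.SquareBound u) (hy : (m.root, y) ∈ m.edges) (hlt : m.root < y) : u ≤ y := by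
  induction m generalizing u with
  | letter x => simp [edges] at hy
  | node k a b iha _ =>
    cases k with
    | square =>
      obtain ⟨ha, hb, hab, hbd⟩ := hm
      obtain ⟨hna, hnb, hdis⟩ := nodup_of_node hn
      rcases Multiset.mem_cons.1 hy with h | h
      · obtain ⟨-, rfl⟩ := Prod.mk.injEq _ _ _ _ ▸ h
        exact hu
      rcases Multiset.mem_add.1 h with h | h
      · exact hu.trans (iha ha hna hbd h hlt)
      · exact (hdis _ a.root_mem_content (mem_content_of_mem_edges h).1).elim
    | angle =>
      have h := child_le_of_angleBound (u := a.root) hm hn le_rfl hy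
      exact absurd (h.trans_lt hm.2.2.1) hlt.not_gt

end Bounds

end Monomial

/-! ### Monomials of forests -/

section Forest

variable {n : ℕ} {H : SimpleGraph (Fin n)} {r c : Fin n}

theorem forestMonomial_square (hadj : H.Adj r c) (hrc : r < c)
    (hmin : ∀ y, H.Adj r y → r < y → c ≤ y) :
    forestMonomial H r = node .square (forestMonomial (H.deleteEdges {s(r, c)}) r)
      (forestMonomial (H.deleteEdges {s(r, c)}) c) := by
  classical
  have hmem : c ∈ Finset.univ.filter fun c => H.Adj r c ∧ r < c := by simp [hadj, hrc]
  have hne : (Finset.univ.filter fun c => H.Adj r c ∧ r < c).Nonempty := ⟨c, hmem⟩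
  have e : (Finset.univ.filter fun c => H.Adj r c ∧ r < c).min' hne = c :=
    le_antisymm (Finset.min'_le _ _ hmem) (Finset.le_min' _ _ _ fun y hy => by
      simp only [Finset.mem_filter] at hy
      exact hmin y hy.2.1 hy.2.2)
  rw [forestMonomial, dif_pos (by convert hne)]
  simp only
  have e' : ∀ (d : Fin n), d = c → node Kind.square (forestMonomial (H.deleteEdges {s(r, d)}) r)
      (forestMonomial (H.deleteEdges {s(r, d)}) d) = node .square
      (forestMonomial (H.deleteEdges {s(r, c)}) r)
      (forestMonomial (H.deleteEdges {s(r, c)}) c) := by rintro d rfl; rfl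
  apply e'
  convert e

theorem forestMonomial_angle (hadj : H.Adj r c) (hlt : ∀ y, H.Adj r y → y < r)
    (hmax : ∀ y, H.Adj r y → y ≤ c) :
    forestMonomial H r = node .angle (forestMonomial (H.deleteEdges {s(r, c)}) c)
      (forestMonomial (H.deleteEdges {s(r, c)}) r) := by
  classical
  have hmem : c ∈ Finset.univ.filter fun c => H.Adj r c := by simp [hadj]
  have hne : (Finset.univ.filter fun c => H.Adj r c).Nonempty := ⟨c, hmem⟩
  have e : (Finset.univ.filter fun c => H.Adj r c).max' hne = c :=
    le_antisymm (Finset.max'_le _ _ _ fun y hy => by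
      simp only [Finset.mem_filter] at hy
      exact hmax y hy.2) (Finset.le_max' _ _ hmem)
  rw [forestMonomial, dif_neg, dif_pos (by convert hne)]
  · simp only
    have e' : ∀ (d : Fin n), d = c → node Kind.angle (forestMonomial (H.deleteEdges {s(r, d)}) d)
        (forestMonomial (H.deleteEdges {s(r, d)}) r) = node .angle
        (forestMonomial (H.deleteEdges {s(r, c)}) c)
        (forestMonomial (H.deleteEdges {s(r, c)}) r) := by rintro d rfl; rfl
    apply e'
    convert e
  · rintro ⟨y, hy⟩
    simp only [Finset.mem_filter] at hy
    exact (hlt y hy.2.1).not_gt hy.2.2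

theorem forestMonomial_letter (h : ∀ y, ¬ H.Adj r y) : forestMonomial H r = letter r := by
  rw [forestMonomial, dif_neg, dif_neg]
  · rintro ⟨y, hy⟩
    simp only [Finset.mem_filter] at hy
    exact h y hy.2
  · rintro ⟨y, hy⟩
    simp only [Finset.mem_filter] at hy
    exact h y hy.2.1

/-- Forgets that the chosen child is extremal: to recover the tree and count its increasing edges,
only the direction of the removed edge matters. -/
theorem forestMonomial_induction {P : SimpleGraph (Fin n) → Fin n → Monomial (Fin n) → Prop}
    (letter : ∀ H r, (∀ y, ¬ H.Adj r y) → P H r (letter r))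
    (square : ∀ (H : SimpleGraph (Fin n)) r c a b, H.Adj r c → r < c →
      P (H.deleteEdges {s(r, c)}) r a → P (H.deleteEdges {s(r, c)}) c b →
      P H r (node .square a b))
    (angle : ∀ (H : SimpleGraph (Fin n)) r c a b, H.Adj r c → c < r →
      P (H.deleteEdges {s(r, c)}) r a → P (H.deleteEdges {s(r, c)}) c b →
      P H r (node .angle b a)) (H : SimpleGraph (Fin n)) (r : Fin n) :
    P H r (forestMonomial H r) := by
  classical
  induction hk : H.edgeSet.ncard using Nat.strong_induction_on generalizing H r with
  | _ k ih =>
  by_cases h : (Finset.univ.filter fun c => H.Adj r c ∧ r < c).Nonempty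
  · have hc := Finset.mem_filter.1 (Finset.min'_mem _ h)
    have hmin := fun y hy => Finset.min'_le (Finset.univ.filter fun c => H.Adj r c ∧ r < c) y hy
    set c := (Finset.univ.filter fun c => H.Adj r c ∧ r < c).min' h
    rw [forestMonomial_square hc.2.1 hc.2.2 fun y h1 h2 => hmin y (by simp [h1, h2])]
    have := hk ▸ ncard_deleteEdges_lt hc.2.1
    exact square _ _ _ _ _ hc.2.1 hc.2.2 (ih _ this _ _ rfl) (ih _ this _ _ rfl)
  · have hlt : ∀ y, H.Adj r y → y < r := fun y hy => by
      by_contra hc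
      exact h ⟨y, by simp [hy, (not_lt.1 hc).lt_of_ne hy.ne]⟩
    by_cases h' : (Finset.univ.filter fun c => H.Adj r c).Nonempty
    · have hc := Finset.mem_filter.1 (Finset.max'_mem _ h')
      have hmax := fun y hy => Finset.le_max' (Finset.univ.filter fun c => H.Adj r c) y hy
      set c := (Finset.univ.filter fun c => H.Adj r c).max' h'
      rw [forestMonomial_angle hc.2 hlt fun y h1 => hmax y (by simp [h1])]
      have := hk ▸ ncard_deleteEdges_lt hc.2
      exact angle _ _ _ _ _ hc.2 (hlt _ hc.2) (ih _ this _ _ rfl) (ih _ this _ _ rfl)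
    · have hno : ∀ y, ¬ H.Adj r y := fun y hy => h' ⟨y, by simp [hy]⟩
      rw [forestMonomial_letter hno]
      exact letter H r hno

theorem reachable_iff_deleteEdges (hadj : H.Adj r c) (v : Fin n) :
    H.Reachable r v ↔ (H.deleteEdges {s(r, c)}).Reachable r v ∨
      (H.deleteEdges {s(r, c)}).Reachable c v := by
  constructor
  · intro h
    rw [SimpleGraph.reachable_iff_reflTransGen] at h
    induction h with
    | refl => exact .inl (.refl _)
    | tail _ hvw ih =>
      rename_i v w _
      by_cases he : s(v, w) = s(r, c)
      · rcases Sym2.eq_iff.1 he with ⟨-, rfl⟩ | ⟨-, rfl⟩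
        · exact .inr (.refl _)
        · exact .inl (.refl _)
      · have : (H.deleteEdges {s(r, c)}).Adj v w := by
          rw [SimpleGraph.deleteEdges_adj]; exact ⟨hvw, he⟩
        exact ih.imp (·.trans this.reachable) (·.trans this.reachable)
  · have hle := SimpleGraph.deleteEdges_le (G := H) {s(r, c)}
    rintro (h | h)
    · exact h.mono hle
    · exact hadj.reachable.trans (h.mono hle)

/-- The rooted tree encoded by the monomial `m` is the component of `r` in the forest `H`. -/
structure Encodes (H : SimpleGraph (Fin n)) (r : Fin n) (m : Monomial (Fin n)) : Prop where
  root_eq : m.root = r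
  nodup : m.content.Nodup
  mem_content : ∀ v, v ∈ m.content ↔ H.Reachable r v
  adj_of_mem : ∀ x y, (x, y) ∈ m.edges → H.Adj x y
  mem_of_adj : ∀ x y, H.Adj x y → H.Reachable r x → (x, y) ∈ m.edges ∨ (y, x) ∈ m.edges

theorem encodes_of_deleteEdges (hH : H.IsAcyclic) (hadj : H.Adj r c) {a b m : Monomial (Fin n)}
    (ha : Encodes (H.deleteEdges {s(r, c)}) r a) (hb : Encodes (H.deleteEdges {s(r, c)}) c b)
    (hroot : m.root = r) (hcont : m.content = a.content + b.content)
    (hedges : m.edges = (r, c) ::ₘ (a.edges + b.edges)) : Encodes H r m where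
  root_eq := hroot
  nodup := by
    rw [hcont, Multiset.nodup_add]
    refine ⟨ha.nodup, hb.nodup, Multiset.disjoint_left.2 fun h1 h2 => ?_⟩
    -- In a forest the removed edge is a bridge, so the two factors have no letter in common.
    have hbr := SimpleGraph.isAcyclic_iff_forall_adj_isBridge.1 hH hadj
    rw [SimpleGraph.isBridge_iff] at hbr
    exact hbr (((ha.mem_content _).1 h1).trans ((hb.mem_content _).1 h2).symm)
  mem_content v := by
    rw [hcont, Multiset.mem_add, ha.mem_content, hb.mem_content, reachable_iff_deleteEdges hadj]
  adj_of_mem x y h := by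
    have hle := SimpleGraph.deleteEdges_le (G := H) {s(r, c)}
    rw [hedges, Multiset.mem_cons, Multiset.mem_add, Prod.mk.injEq] at h
    rcases h with ⟨rfl, rfl⟩ | h | h
    · exact hadj
    · exact hle (ha.adj_of_mem x y h)
    · exact hle (hb.adj_of_mem x y h)
  mem_of_adj x y h hx := by
    simp only [hedges, Multiset.mem_cons, Multiset.mem_add]
    by_cases he : s(x, y) = s(r, c)
    · rcases Sym2.eq_iff.1 he with ⟨rfl, rfl⟩ | ⟨rfl, rfl⟩
      · exact .inl (.inl rfl)
      · exact .inr (.inl rfl)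
    · have hxy : (H.deleteEdges {s(r, c)}).Adj x y := by
        rw [SimpleGraph.deleteEdges_adj]; exact ⟨h, he⟩
      rcases (reachable_iff_deleteEdges hadj x).1 hx with hx | hx
      · rcases ha.mem_of_adj x y hxy hx with h | h <;> simp [h]
      · rcases hb.mem_of_adj x y hxy hx with h | h <;> simp [h]

theorem encodes_forestMonomial (hH : H.IsAcyclic) (r : Fin n) :
    Encodes H r (forestMonomial H r) ∧
      (forestMonomial H r).count .square =
        (forestMonomial H r).edges.countP fun e => e.1 < e.2 := by
  revert hH
  refine forestMonomial_induction
    (P := fun H r m => H.IsAcyclic → Encodes H r m ∧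
      m.count .square = m.edges.countP fun e => e.1 < e.2) ?_ ?_ ?_ H r
  · intro H r hno _
    refine ⟨⟨rfl, Multiset.nodup_singleton r, fun v => ?_, fun x y h => ?_, fun x y h hx => ?_⟩, rfl⟩
    · rw [content, Multiset.mem_singleton]
      constructor
      · rintro rfl; exact .refl _
      · intro h
        rw [SimpleGraph.reachable_iff_reflTransGen] at h
        rcases h.cases_head with h | ⟨y, h, -⟩
        · exact h.symm
        · exact (hno y h).elim
    · simp [edges] at h
    · rw [SimpleGraph.reachable_iff_reflTransGen] at hx
      rcases hx.cases_head with rfl | ⟨y, h, -⟩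
      · exact (hno y h).elim
      · exact (hno y h).elim
  · intro H r c a b hadj hlt iha ihb hH
    obtain ⟨ha, ha'⟩ := iha (hH.anti (SimpleGraph.deleteEdges_le _))
    obtain ⟨hb, hb'⟩ := ihb (hH.anti (SimpleGraph.deleteEdges_le _))
    refine ⟨encodes_of_deleteEdges hH hadj ha hb ha.root_eq rfl ?_, ?_⟩
    · rw [edges, ha.root_eq, hb.root_eq]
    · rw [edges, ha.root_eq, hb.root_eq,
        Multiset.countP_cons_of_pos (p := fun e : Fin n × Fin n => e.1 < e.2) _ hlt,
        Multiset.countP_add, ← ha', ← hb', count_square_node, Kind.weight]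
  · intro H r c a b hadj hlt iha ihb hH
    obtain ⟨ha, ha'⟩ := iha (hH.anti (SimpleGraph.deleteEdges_le _))
    obtain ⟨hb, hb'⟩ := ihb (hH.anti (SimpleGraph.deleteEdges_le _))
    refine ⟨encodes_of_deleteEdges hH hadj ha hb ha.root_eq (add_comm _ _) ?_, ?_⟩
    · rw [edges, ha.root_eq, hb.root_eq, add_comm b.edges]
    · rw [edges, ha.root_eq, hb.root_eq,
        Multiset.countP_cons_of_neg (p := fun e : Fin n × Fin n => e.1 < e.2) _ hlt.not_gt,
        Multiset.countP_add, ← ha', ← hb', count_square_node, Kind.weight, add_zero]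

end Forest

/-! ### Normal monomials are monomials of rooted trees -/

section Normal

variable {n : ℕ}

/-- Near the letters of `m`, the edges of the graph `H` are those of `m`. -/
def Agrees (H : SimpleGraph (Fin n)) (m : Monomial (Fin n)) : Prop :=
  ∀ x ∈ m.content, ∀ y, H.Adj x y ↔ (x, y) ∈ m.edges ∨ (y, x) ∈ m.edges

theorem agrees_deleteEdges {H : SimpleGraph (Fin n)} {r c : Fin n} {m a b : Monomial (Fin n)}
    (h : Agrees H m) (hcont : ∀ x ∈ a.content, x ∈ m.content)
    (hedges : ∀ e, e ∈ m.edges ↔ e = (r, c) ∨ e ∈ a.edges ∨ e ∈ b.edges)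
    (hdis : ∀ x ∈ a.content, x ∉ b.content) (hrc : r ∉ a.content ∨ c ∉ a.content) :
    Agrees (H.deleteEdges {s(r, c)}) a := by
  intro x hx y
  rw [SimpleGraph.deleteEdges_adj, h x (hcont x hx), hedges, hedges, Set.mem_singleton_iff,
    Sym2.eq_iff, Prod.mk.injEq, Prod.mk.injEq]
  have hb1 : (x, y) ∉ b.edges := fun hb => hdis x hx (mem_content_of_mem_edges hb).1
  have hb2 : (y, x) ∉ b.edges := fun hb => hdis x hx (mem_content_of_mem_edges hb).2
  have h1 : ∀ u v, (u, v) ∈ a.edges → ¬ ((u = r ∧ v = c) ∨ (u = c ∧ v = r)) := by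
    rintro u v huv (⟨rfl, rfl⟩ | ⟨rfl, rfl⟩)
    · exact hrc.elim (· (mem_content_of_mem_edges huv).1) (· (mem_content_of_mem_edges huv).2)
    · exact hrc.elim (· (mem_content_of_mem_edges huv).2) (· (mem_content_of_mem_edges huv).1)
  constructor
  · rintro ⟨(e | h | h) | (e | h | h), hne⟩
    · exact (hne (.inl e)).elim
    · exact .inl h
    · exact (hb1 h).elim
    · exact (hne (.inr e.symm)).elim
    · exact .inr h
    · exact (hb2 h).elim
  · rintro (h | h)
    · exact ⟨.inl (.inr (.inl h)), h1 x y h⟩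
    · exact ⟨.inr (.inr (.inl h)), fun e => h1 y x h (e.symm.imp And.symm And.symm)⟩

/-- The two bounds in `Normal` say that the outermost bracket removes the very edge selected by
`forestMonomial`. Agreement is required only near the letters of `m`, since after the removal the
other factor is still part of the graph. -/
theorem forestMonomial_eq_of_agrees {m : Monomial (Fin n)} (hm : m.Normal)
    (hn : m.content.Nodup) {H : SimpleGraph (Fin n)} (h : Agrees H m) :
    forestMonomial H m.root = m := by
  induction m generalizing H with
  | letter x =>
    refine forestMonomial_letter fun y hy => ?_
    have := (h x (Multiset.mem_singleton_self x) y).1 hy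
    simp [edges] at this
  | node k a b iha ihb =>
    obtain ⟨hna, hnb, hdis⟩ := nodup_of_node hn
    have hdis' : ∀ x ∈ b.content, x ∉ a.content := fun x hb ha => hdis x ha hb
    have hra := a.root_mem_content
    have hrb := b.root_mem_content
    have hca : ∀ x ∈ a.content, x ∈ (node k a b).content := fun x hx =>
      Multiset.mem_add.2 (.inl hx)
    have hcb : ∀ x ∈ b.content, x ∈ (node k a b).content := fun x hx =>
      Multiset.mem_add.2 (.inr hx)
    have hadj : ∀ y, H.Adj (node k a b).root y → ((node k a b).root, y) ∈ (node k a b).edges :=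
      fun y hy => ((h _ (root_mem_content _) y).1 hy).resolve_right (not_mem_edges_root hn y)
    cases k with
    | square =>
      obtain ⟨ha, hb, hab, hbd⟩ := id hm
      have hedges : ∀ e, e ∈ (node .square a b).edges ↔
          e = (a.root, b.root) ∨ e ∈ a.edges ∨ e ∈ b.edges := fun e => by
        rw [edges, Multiset.mem_cons, Multiset.mem_add]
      change forestMonomial H a.root = _
      rw [forestMonomial_square (c := b.root), iha ha hna, ihb hb hnb]
      · exact agrees_deleteEdges (b := a) h hcb
          (fun e => by rw [hedges e, or_comm (a := e ∈ b.edges)]) hdis' (.inl (hdis _ hra))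
      · exact agrees_deleteEdges h hca hedges hdis (.inr (hdis' _ hrb))
      · exact (h _ (hca _ hra) _).2 (.inl ((hedges _).2 (.inl rfl)))
      · exact hab
      · intro y hy hlt
        exact le_child_of_squareBound (u := b.root) hm hn le_rfl (hadj y hy) hlt
    | angle =>
      obtain ⟨ha, hb, hab, hbd⟩ := id hm
      have hedges : ∀ e, e ∈ (node .angle a b).edges ↔
          e = (b.root, a.root) ∨ e ∈ a.edges ∨ e ∈ b.edges := fun e => by
        rw [edges, Multiset.mem_cons, Multiset.mem_add]
      have hle : ∀ y, H.Adj b.root y → y ≤ a.root := fun y hy =>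
        child_le_of_angleBound (u := a.root) hm hn le_rfl (hadj y hy)
      change forestMonomial H b.root = _
      rw [forestMonomial_angle (c := a.root), iha ha hna, ihb hb hnb]
      · exact agrees_deleteEdges (b := a) h hcb
          (fun e => by rw [hedges e, or_comm (a := e ∈ b.edges)]) hdis' (.inr (hdis _ hra))
      · exact agrees_deleteEdges h hca hedges hdis (.inl (hdis' _ hrb))
      · exact (h _ (hcb _ hrb) _).2 (.inl ((hedges _).2 (.inl rfl)))
      · exact fun y hy => (hle y hy).trans_lt hab
      · exact hle

theorem fst_ne_snd_of_mem_edges {X : Type} {m : Monomial X} (hn : m.content.Nodup) {x y : X}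
    (h : (x, y) ∈ m.edges) : x ≠ y := by
  induction m with
  | letter x => simp [edges] at h
  | node k a b iha ihb =>
    obtain ⟨hna, hnb, hdis⟩ := nodup_of_node hn
    have hne : a.root ≠ b.root := fun e => hdis _ a.root_mem_content (e ▸ b.root_mem_content)
    have hab : (x, y) ∈ a.edges + b.edges → x ≠ y := fun h =>
      (Multiset.mem_add.1 h).elim (iha hna) (ihb hnb)
    cases k with
    | square =>
      rcases Multiset.mem_cons.1 h with h | h
      · obtain ⟨rfl, rfl⟩ := Prod.mk.injEq _ _ _ _ ▸ h
        exact hne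
      · exact hab h
    | angle =>
      rcases Multiset.mem_cons.1 h with h | h
      · obtain ⟨rfl, rfl⟩ := Prod.mk.injEq _ _ _ _ ▸ h
        exact hne.symm
      · exact hab h

/-- The graph with the edges of a monomial. -/
def edgeGraph (m : Monomial (Fin n)) : SimpleGraph (Fin n) :=
  SimpleGraph.fromRel fun x y => (x, y) ∈ m.edges

theorem edgeGraph_adj {m : Monomial (Fin n)} (hn : m.content.Nodup) {x y : Fin n} :
    (edgeGraph m).Adj x y ↔ (x, y) ∈ m.edges ∨ (y, x) ∈ m.edges := by
  rw [edgeGraph, SimpleGraph.fromRel_adj]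
  refine ⟨fun h => h.2, fun h => ⟨?_, h⟩⟩
  rcases h with h | h
  · exact fst_ne_snd_of_mem_edges hn h
  · exact (fst_ne_snd_of_mem_edges hn h).symm

theorem reachable_root {m : Monomial (Fin n)} {H : SimpleGraph (Fin n)}
    (h : ∀ x y, (x, y) ∈ m.edges → H.Adj x y) {v : Fin n} (hv : v ∈ m.content) :
    H.Reachable m.root v := by
  induction m with
  | letter x => rw [content, Multiset.mem_singleton] at hv; subst hv; exact .refl _
  | node k a b iha ihb =>
    have ha : ∀ x y, (x, y) ∈ a.edges → H.Adj x y := fun x y hxy => h x y (by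
      cases k <;> simp [edges, hxy])
    have hb : ∀ x y, (x, y) ∈ b.edges → H.Adj x y := fun x y hxy => h x y (by
      cases k <;> simp [edges, hxy])
    cases k with
    | square =>
      rcases Multiset.mem_add.1 hv with hv | hv
      · exact iha ha hv
      · exact (h a.root b.root (Multiset.mem_cons_self _ _)).reachable.trans (ihb hb hv)
    | angle =>
      rcases Multiset.mem_add.1 hv with hv | hv
      · exact (h b.root a.root (Multiset.mem_cons_self _ _)).reachable.trans (iha ha hv)
      · exact ihb hb hv

theorem card_edgeSet_edgeGraph_le {m : Monomial (Fin n)} :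
    Nat.card (edgeGraph m).edgeSet ≤ m.edges.card := by
  classical
  have hsub : (edgeGraph m).edgeSet ⊆ ((m.edges.map fun e => s(e.1, e.2)).toFinset : Set _) := by
    intro e
    induction e with
    | _ x y =>
    rw [SimpleGraph.mem_edgeSet, edgeGraph, SimpleGraph.fromRel_adj]
    rintro ⟨-, h | h⟩
    · simpa using ⟨x, y, h, .inl ⟨rfl, rfl⟩⟩
    · simpa using ⟨y, x, h, .inr ⟨rfl, rfl⟩⟩
  calc Nat.card (edgeGraph m).edgeSet = (edgeGraph m).edgeSet.ncard := rfl
    _ ≤ ((m.edges.map fun e => s(e.1, e.2)).toFinset : Set _).ncard :=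
      Set.ncard_le_ncard hsub (Set.toFinite _)
    _ ≤ m.edges.card := by
      rw [Set.ncard_coe_finset]
      exact (Multiset.toFinset_card_le _).trans_eq (Multiset.card_map _ _)

theorem isTree_edgeGraph {m : Monomial (Fin n)} (hn : m.content = Finset.univ.val) :
    (edgeGraph m).IsTree := by
  have hnd : m.content.Nodup := hn ▸ Finset.univ.nodup
  have hconn : (edgeGraph m).Connected := by
    rw [SimpleGraph.connected_iff_exists_forall_reachable]
    refine ⟨m.root, fun v => reachable_root (fun x y h => (edgeGraph_adj hnd).2 (.inl h)) ?_⟩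
    rw [hn]
    exact Finset.mem_univ v
  refine SimpleGraph.isTree_iff_connected_and_card.2 ⟨hconn, ?_⟩
  -- A connected graph is a tree once it has few enough edges, and a monomial has one edge fewer
  -- than letters.
  refine le_antisymm ?_ hconn.card_vert_le_card_edgeSet_add_one
  refine (Nat.add_le_add_right card_edgeSet_edgeGraph_le 1).trans_eq ?_
  rw [card_edges, hn]
  simp

theorem isMultilinear_iff {m : Monomial (Fin n)} :
    m.IsMultilinear ↔ m.content = Finset.univ.val := by
  rw [IsMultilinear, Multiset.ext]
  refine forall_congr' fun x => ?_
  rw [← coe_letters, Multiset.coe_count, Multiset.count_eq_one_of_mem Finset.univ.nodup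
    (Finset.mem_univ x)]

theorem exists_rootedTree_monomial_eq {m : Monomial (Fin n)} (hm : m.Normal)
    (hn : m.content = Finset.univ.val) : ∃ T : RootedTree n, T.monomial = m := by
  have hnd : m.content.Nodup := hn ▸ Finset.univ.nodup
  exact ⟨⟨edgeGraph m, isTree_edgeGraph hn, m.root⟩,
    forestMonomial_eq_of_agrees hm hnd fun x _ y => edgeGraph_adj hnd⟩

end Normal

/-! ### Orientations of rooted trees -/

namespace RootedTree

variable {n : ℕ} (T : RootedTree n)

theorem exists_isParent {v : Fin n} (h : v ≠ T.root) : ∃ p, T.IsParent p v := by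
  obtain ⟨w, hw⟩ := T.isTree.connected.exists_walk_length_eq_dist v T.root
  cases w with
  | nil => exact absurd rfl h
  | cons hadj w =>
    rename_i p
    refine ⟨p, hadj.symm, ?_⟩
    rw [SimpleGraph.dist_comm, SimpleGraph.dist_comm (v := v), ← hw,
      SimpleGraph.Walk.length_cons]
    exact Nat.lt_succ_of_le (SimpleGraph.dist_le w)

theorem isParent_iff_of_orientation {O : Fin n → Fin n → Prop}
    (hadj : ∀ x y, T.graph.Adj x y → O x y ∨ O y x) (huniq : ∀ x y z, O x z → O y z → x = y)
    (hroot : ∀ x, ¬ O x T.root) (x y : Fin n) : T.IsParent x y ↔ O x y := by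
  have key : ∀ d p v, T.graph.dist T.root p = d → T.IsParent p v → O p v := by
    intro d
    induction d using Nat.strong_induction_on with
    | _ d ih =>
    intro p v hd hpv
    refine (hadj p v hpv.1).resolve_right fun hvp => ?_
    obtain ⟨q, hq⟩ := T.exists_isParent (v := p) (fun e => hroot v (e ▸ hvp))
    have := huniq _ _ _ hvp (ih _ (hd ▸ hq.2) q p rfl hq)
    subst this
    exact hq.2.not_gt hpv.2
  refine ⟨key _ x y rfl, fun h => ?_⟩
  obtain ⟨p, hp⟩ := T.exists_isParent (v := y) (fun e => hroot x (e ▸ h))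
  rwa [huniq _ _ _ h (key _ _ _ rfl hp)]

theorem encodes_monomial : Encodes T.graph T.root T.monomial :=
  (encodes_forestMonomial T.isTree.isAcyclic T.root).1

theorem content_monomial : T.monomial.content = Finset.univ.val :=
  (Multiset.Nodup.ext T.encodes_monomial.nodup Finset.univ.nodup).2 fun v => by
    simp [T.encodes_monomial.mem_content, T.isTree.connected.preconnected T.root v]

theorem isMultilinear_monomial : T.monomial.IsMultilinear :=
  isMultilinear_iff.2 T.content_monomial

theorem isParent_iff_mem_edges (x y : Fin n) : T.IsParent x y ↔ (x, y) ∈ T.monomial.edges :=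
  T.isParent_iff_of_orientation
    (fun x y h => T.encodes_monomial.mem_of_adj x y h (T.isTree.connected.preconnected _ _))
    (fun _ _ _ => parent_unique T.encodes_monomial.nodup)
    (fun x => by
      have h := not_mem_edges_root T.encodes_monomial.nodup x
      rwa [T.encodes_monomial.root_eq] at h) x y

theorem isParent_unique {x y z : Fin n} (hx : T.IsParent x z) (hy : T.IsParent y z) : x = y := by
  rw [isParent_iff_mem_edges] at hx hy
  exact parent_unique T.encodes_monomial.nodup hx hy

theorem isParent_or_isParent {x y : Fin n} (h : T.graph.Adj x y) :
    T.IsParent x y ∨ T.IsParent y x := by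
  rw [isParent_iff_mem_edges, isParent_iff_mem_edges]
  exact T.encodes_monomial.mem_of_adj x y h (T.isTree.connected.preconnected _ _)

theorem not_isParent_root (x : Fin n) : ¬ T.IsParent x T.root := fun h => by
  have := h.2
  simp at this

theorem ext {T T' : RootedTree n} (hg : T.graph = T'.graph) (hr : T.root = T'.root) : T = T' := by
  cases T; cases T'; cases hg; cases hr; rfl

theorem treeData_monomial_injective :
    Function.Injective fun T : RootedTree n => T.monomial.treeData := by
  intro T T' h
  have hroot : T.monomial.root = T'.monomial.root := congrArg Prod.fst h
  have hedges : T.monomial.edges = T'.monomial.edges := congrArg (fun t => t.2.2) h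
  rw [T.encodes_monomial.root_eq, T'.encodes_monomial.root_eq] at hroot
  have hadj : ∀ (T : RootedTree n) x y,
      T.graph.Adj x y ↔ (x, y) ∈ T.monomial.edges ∨ (y, x) ∈ T.monomial.edges := fun T x y =>
    ⟨fun h => T.encodes_monomial.mem_of_adj x y h (T.isTree.connected.preconnected _ _), fun h =>
      h.elim (T.encodes_monomial.adj_of_mem x y) fun h => (T.encodes_monomial.adj_of_mem y x h).symm⟩
  refine ext ?_ hroot
  ext x y
  rw [hadj, hadj, hedges]

instance : Finite (RootedTree n) :=
  Finite.of_injective (fun T : RootedTree n => (T.graph, T.root)) fun _ _ h =>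
    ext (congrArg Prod.fst h) (congrArg Prod.snd h)

theorem count_square_monomial : T.monomial.count .square = T.numIncreasing := by
  classical
  rw [monomial, (encodes_forestMonomial T.isTree.isAcyclic T.root).2]
  change T.monomial.edges.countP _ = _
  have hnd : T.monomial.edges.Nodup :=
    .of_map _ (nodup_map_snd_edges T.encodes_monomial.nodup)
  have e : T.increasingEdges = (fun e : Fin n × Fin n => s(e.1, e.2)) ''
      ((T.monomial.edges.filter fun e => e.1 < e.2).toFinset : Set (Fin n × Fin n)) := by
    ext e
    simp only [increasingEdges, Set.mem_ofPred_eq, isParent_iff_mem_edges, Set.mem_image,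
      Finset.mem_coe, Multiset.mem_toFinset, Multiset.mem_filter, Prod.exists]
    constructor
    · rintro ⟨i, j, rfl, h, hij⟩
      exact ⟨i, j, ⟨h, hij⟩, rfl⟩
    · rintro ⟨i, j, ⟨h, hij⟩, rfl⟩
      exact ⟨i, j, rfl, h, hij⟩
  rw [numIncreasing, e, Set.InjOn.ncard_image, Set.ncard_coe_finset,
    Multiset.toFinset_card_of_nodup (hnd.filter _), Multiset.countP_eq_card_filter]
  rintro ⟨x, y⟩ hx ⟨x', y'⟩ hx' h
  simp only [Finset.mem_coe, Multiset.mem_toFinset, Multiset.mem_filter] at hx hx'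
  rcases Sym2.eq_iff.1 h with ⟨h1, h2⟩ | ⟨h1, h2⟩
  · exact Prod.ext h1 h2
  · have := hx.2
    have := hx'.2
    simp only at h1 h2
    omega

end RootedTree

/-! ### The color map -/

namespace RootedTree

variable {n : ℕ} (T : RootedTree n)

theorem color_red_adj {x y : Fin n} (h : x < y) : T.color.red.Adj x y ↔ T.IsParent x y := by
  change (SimpleGraph.fromEdgeSet T.increasingEdges).Adj x y ↔ _
  rw [SimpleGraph.fromEdgeSet_adj]
  constructor
  · rintro ⟨⟨i, j, e, hp, hij⟩, -⟩
    rcases Sym2.eq_iff.1 e with ⟨rfl, rfl⟩ | ⟨rfl, rfl⟩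
    · exact hp
    · exact absurd h hij.not_gt
  · exact fun hp => ⟨⟨x, y, rfl, hp, h⟩, h.ne⟩

theorem color_blue_adj {x y : Fin n} (h : x < y) : T.color.blue.Adj x y ↔ T.IsParent y x := by
  rw [TwoColoredGraph.blue, SimpleGraph.sdiff_adj, color_red_adj T h]
  constructor
  · rintro ⟨h1, h2⟩
    exact (T.isParent_or_isParent h1).resolve_left h2
  · exact fun hp => ⟨hp.1.symm, fun hp' => hp.2.not_gt hp'.2⟩

theorem color_mem_avoidingTrees : T.color ∈ TwoColoredGraph.avoidingTrees n := by
  refine ⟨T.isTree, ?_, ?_, ?_⟩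
  · rintro ⟨i, j, k, hij, hjk, h1, h2⟩
    rw [color_red_adj T (hij.trans hjk)] at h1
    rw [color_red_adj T hjk] at h2
    exact hij.ne (T.isParent_unique h1 h2)
  · rintro ⟨i, j, k, hij, hjk, h1, h2⟩
    rw [color_blue_adj T hij] at h1
    rw [color_blue_adj T (hij.trans hjk)] at h2
    exact hjk.ne (T.isParent_unique h1 h2)
  · rintro ⟨i, j, k, hij, hjk, h1, h2⟩
    rw [color_red_adj T hij] at h1
    rw [color_blue_adj T hjk] at h2
    exact (hij.trans hjk).ne (T.isParent_unique h1 h2)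

theorem numRed_color : T.color.numRed = T.numIncreasing := by
  change (SimpleGraph.fromEdgeSet T.increasingEdges).edgeSet.ncard = T.increasingEdges.ncard
  rw [SimpleGraph.edgeSet_fromEdgeSet, sdiff_eq_left.2]
  rw [Set.disjoint_left]
  rintro _ ⟨i, j, rfl, -, hij⟩ h
  exact hij.ne (by simpa using h)

theorem color_injective : Function.Injective (color (n := n)) := by
  intro T T' h
  have hg : T.graph = T'.graph := congrArg TwoColoredGraph.graph h
  have hpar : ∀ x y, T.IsParent x y → T'.IsParent x y := by
    intro x y hxy
    rcases lt_or_gt_of_ne hxy.1.ne with hlt | hlt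
    · rw [← color_red_adj T hlt, h, color_red_adj T' hlt] at hxy
      exact hxy
    · rw [← color_blue_adj T hlt, h, color_blue_adj T' hlt] at hxy
      exact hxy
  refine ext hg ?_
  by_contra hne
  obtain ⟨p, hp⟩ := T.exists_isParent (Ne.symm hne)
  exact T'.not_isParent_root p (hpar _ _ hp)

end RootedTree

namespace TwoColoredGraph

variable {n : ℕ} (G : TwoColoredGraph n)

/-- The orientation of the edges of a two-colored graph for which exactly the red edges are
increasing. -/
def Orientation (x y : Fin n) : Prop :=
  (x < y ∧ G.red.Adj x y) ∨ (y < x ∧ G.blue.Adj x y)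

variable {G}

theorem Orientation.adj {x y : Fin n} (h : G.Orientation x y) : G.graph.Adj x y :=
  h.elim (fun h => G.red_le h.2) fun h => h.2.1

theorem orientation_or_orientation {x y : Fin n} (h : G.graph.Adj x y) :
    G.Orientation x y ∨ G.Orientation y x := by
  have hb : ¬ G.red.Adj x y → G.blue.Adj x y := fun hr => ⟨h, hr⟩
  rcases lt_or_gt_of_ne h.ne with hlt | hlt
  · by_cases hr : G.red.Adj x y
    · exact .inl (.inl ⟨hlt, hr⟩)
    · exact .inr (.inr ⟨hlt, (hb hr).symm⟩)
  · by_cases hr : G.red.Adj x y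
    · exact .inr (.inl ⟨hlt, hr.symm⟩)
    · exact .inl (.inr ⟨hlt, hb hr⟩)

theorem Orientation.asymm {x y : Fin n} (h : G.Orientation x y) : ¬ G.Orientation y x := by
  rintro (h' | h') <;> rcases h with h | h
  · exact h.1.not_gt h'.1
  · exact h.2.2 h'.2.symm
  · exact h'.2.2 h.2.symm
  · exact h.1.not_gt h'.1

theorem orientation_unique (hG : G ∈ avoidingTrees n) {x y z : Fin n} (hx : G.Orientation x z)
    (hy : G.Orientation y z) : x = y := by
  obtain ⟨-, h1, h2, h3⟩ := hG
  by_contra hne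
  rcases hx with hx | hx <;> rcases hy with hy | hy
  · rcases lt_or_gt_of_ne hne with hlt | hlt
    · exact h1 ⟨x, y, z, hlt, hy.1, hx.2, hy.2⟩
    · exact h1 ⟨y, x, z, hlt, hx.1, hy.2, hx.2⟩
  · exact h3 ⟨x, z, y, hx.1, hy.1, hx.2, hy.2.symm⟩
  · exact h3 ⟨y, z, x, hy.1, hx.1, hy.2, hx.2.symm⟩
  · rcases lt_or_gt_of_ne hne with hlt | hlt
    · exact h2 ⟨z, x, y, hx.1, hlt, hx.2.symm, hy.2.symm⟩
    · exact h2 ⟨z, y, x, hy.1, hlt, hy.2.symm, hx.2.symm⟩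

theorem exists_root (hG : G ∈ avoidingTrees n) : ∃ r, ∀ x, ¬ G.Orientation x r := by
  by_contra! h
  choose p hp using h
  have hinj : Function.Injective fun v => (⟨s(p v, v), (hp v).adj⟩ : G.graph.edgeSet) := by
    intro v w hvw
    rcases Sym2.eq_iff.1 (congrArg Subtype.val hvw) with ⟨-, h⟩ | ⟨h1, h2⟩
    · exact h
    · have h3 := hp v
      have h4 := hp w
      rw [h1] at h3
      rw [← h2] at h4
      exact (h3.asymm h4).elim
  have : Nat.card (Fin n) ≤ Nat.card G.graph.edgeSet := Nat.card_le_card_of_injective _ hinj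
  have := (SimpleGraph.isTree_iff_connected_and_card.1 hG.1).2
  omega

theorem ext {G G' : TwoColoredGraph n} (hg : G.graph = G'.graph) (hr : G.red = G'.red) :
    G = G' := by
  cases G; cases G'; cases hg; cases hr; rfl

theorem exists_color_eq (hG : G ∈ avoidingTrees n) : ∃ T : RootedTree n, T.color = G := by
  obtain ⟨r, hr⟩ := exists_root hG
  set T : RootedTree n := ⟨G.graph, hG.1, r⟩ with hT
  have hpar := T.isParent_iff_of_orientation (O := G.Orientation)
    (fun x y h => orientation_or_orientation h) (fun x y z => orientation_unique hG) hr
  have hlt : ∀ x y, x < y → (T.color.red.Adj x y ↔ G.red.Adj x y) := by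
    intro x y hlt
    rw [T.color_red_adj hlt, hpar]
    exact ⟨fun h => h.elim And.right fun h => absurd hlt h.1.not_gt, fun h => .inl ⟨hlt, h⟩⟩
  refine ⟨T, ext rfl ?_⟩
  ext x y
  rcases lt_trichotomy x y with h | rfl | h
  · exact hlt x y h
  · simp
  · rw [SimpleGraph.adj_comm, hlt y x h, SimpleGraph.adj_comm]

end TwoColoredGraph

theorem bijOn_color (n i : ℕ) : Set.BijOn (RootedTree.color (n := n))
    {T | T.numIncreasing = i} {G | G ∈ TwoColoredGraph.avoidingTrees n ∧ G.numRed = i} := by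
  refine ⟨fun T hT => ⟨T.color_mem_avoidingTrees, T.numRed_color.trans hT⟩,
    RootedTree.color_injective.injOn, ?_⟩
  rintro G ⟨hG, hi⟩
  obtain ⟨T, rfl⟩ := TwoColoredGraph.exists_color_eq hG
  exact ⟨T, T.numRed_color.symm.trans hi, rfl⟩

/-! ### The basis -/

section Basis

variable (R : Type*) [CommRing R] (n : ℕ)

/-- The monomial of a rooted tree, as an element of the multilinear part. -/
noncomputable def treeMon (T : RootedTree n) : Lie2 R n :=
  ⟨mon R T.monomial, Submodule.subset_span ⟨_, T.isMultilinear_monomial, rfl⟩⟩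

variable {n}

theorem mon_mem_span_treeMon {m : Monomial (Fin n)} (hm : m.IsMultilinear) :
    mon R m ∈ Submodule.span R
      {u | ∃ T : RootedTree n, T.numIncreasing = m.count .square ∧ u = mon R T.monomial} := by
  rw [isMultilinear_iff] at hm
  have h := mon_mem_monSpan_normal (R := R) m (hm ▸ Finset.univ.nodup)
  refine Submodule.span_mono ?_ h
  rintro _ ⟨m', ⟨h1, h2, h3⟩, rfl⟩
  obtain ⟨T, rfl⟩ := exists_rootedTree_monomial_eq h1 (h2.trans hm)
  exact ⟨T, T.count_square_monomial.symm.trans h3, rfl⟩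

theorem lie2Part_eq (i : ℕ) :
    Lie2Part R n i = Submodule.span R (treeMon R n '' {T | T.numIncreasing = i}) := by
  apply le_antisymm
  · refine Submodule.span_le.2 ?_
    rintro u ⟨m, hm, hi, hu⟩
    have h := mon_mem_span_treeMon R hm
    rw [← hu] at h
    have e : {u | ∃ T : RootedTree n, T.numIncreasing = m.count .square ∧ u = mon R T.monomial} =
        (Lie2 R n).subtype '' (treeMon R n '' {T | T.numIncreasing = i}) := by
      ext v
      simp only [Set.mem_ofPred_eq, Set.mem_image, exists_exists_and_eq_and, hi]
      exact exists_congr fun T => and_congr_right fun _ => eq_comm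
    rw [e, Submodule.span_image] at h
    obtain ⟨w, hw, hwu⟩ := h
    rwa [Subtype.ext hwu] at hw
  · refine Submodule.span_mono ?_
    rintro _ ⟨T, hT, rfl⟩
    exact ⟨T.monomial, T.isMultilinear_monomial, T.count_square_monomial.trans hT, rfl⟩

theorem span_treeMon : Submodule.span R (Set.range (treeMon R n)) = ⊤ := by
  have e : Submodule.map (Lie2 R n).subtype (Submodule.span R (Set.range (treeMon R n))) =
      Lie2 R n := by
    apply le_antisymm (Submodule.map_subtype_le _ _)
    refine Submodule.span_le.2 ?_
    rintro _ ⟨m, hm, rfl⟩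
    rw [← Submodule.span_image, ← Set.range_comp]
    refine Submodule.span_mono ?_ (mon_mem_span_treeMon R hm)
    rintro _ ⟨T, -, rfl⟩
    exact ⟨T, rfl⟩
  rw [eq_top_iff]
  intro u _
  have hu := e.ge u.2
  obtain ⟨v, hv, hvu⟩ := hu
  rwa [← Subtype.ext hvu]

/-- The coefficients of the tree data of all rooted trees. -/
noncomputable def treeCoeff : Lie2 R n →ₗ[R] (RootedTree n → R) :=
  LinearMap.pi fun T =>
    (Finsupp.lapply T.monomial.treeData).comp ((treeHom R (Fin n)).comp (Lie2 R n).subtype)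

theorem treeCoeff_surjective : Function.Surjective (treeCoeff R (n := n)) := by
  classical
  rw [← LinearMap.range_eq_top, eq_top_iff, ← (Pi.basisFun R (RootedTree n)).span_eq,
    Submodule.span_le]
  rintro _ ⟨T, rfl⟩
  have h := single_mem_treeImage (R := R) T.monomial.isRootedTree_treeData
    T.encodes_monomial.nodup
  obtain ⟨u, hu, hT⟩ := h
  have hle : monSpan R (fun m => m.content = T.monomial.treeData.2.1) ≤ Lie2 R n := by
    refine Submodule.span_mono ?_
    rintro _ ⟨m, hm, rfl⟩
    exact ⟨m, isMultilinear_iff.2 (hm.trans T.content_monomial), rfl⟩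
  refine ⟨⟨u, hle hu⟩, ?_⟩
  ext T'
  rw [Pi.basisFun_apply]
  change treeHom R (Fin n) u T'.monomial.treeData = _
  rw [hT, Finsupp.single_apply, Pi.single_apply]
  refine if_congr ⟨fun h => (RootedTree.treeData_monomial_injective h).symm, fun h => h ▸ rfl⟩ rfl
    rfl

theorem linearIndependent_treeMon : LinearIndependent R (treeMon R n) := by
  have := Fintype.ofFinite (RootedTree n)
  set f := Fintype.linearCombination R (treeMon R n)
  have hf : Function.Surjective f := by
    rw [← LinearMap.range_eq_top, Fintype.range_linearCombination, span_treeMon]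
  have h := OrzechProperty.injective_of_surjective_endomorphism ((treeCoeff R).comp f)
    ((treeCoeff_surjective R).comp hf)
  rw [LinearMap.coe_comp] at h
  exact linearIndependent_iff_injective_fintypeLinearCombination.2 h.of_comp

theorem isInternal_lie2Part (n : ℕ) :
    DirectSum.IsInternal (fun i : Fin n => Lie2Part R n (i : ℕ)) := by
  have hli := linearIndependent_treeMon R (n := n)
  apply DirectSum.isInternal_submodule_of_iSupIndep_of_iSup_eq_top
  · intro i
    have e : ∀ j : Fin n, Lie2Part R n j = _ := fun j => lie2Part_eq R j
    simp only [e, ← Submodule.span_iUnion, ← Set.image_iUnion]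
    refine hli.disjoint_span_image (Set.disjoint_left.2 fun T hT hT' => ?_)
    simp only [Set.mem_iUnion] at hT'
    obtain ⟨j, hj, hT'⟩ := hT'
    exact hj (Fin.ext (hT'.symm.trans hT))
  · rw [eq_top_iff, ← span_treeMon R, Submodule.span_le]
    rintro _ ⟨T, rfl⟩
    have hlt : T.numIncreasing < n := by
      rw [← T.count_square_monomial]
      refine (count_square_lt_size _).trans_eq ?_
      rw [← card_content, T.content_monomial]
      simp
    refine Submodule.mem_iSup_of_mem ⟨_, hlt⟩ ?_
    rw [lie2Part_eq]
    exact Submodule.subset_span ⟨T, rfl, rfl⟩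

theorem exists_basis_lie2Part (n i : ℕ) :
    ∃ B : Module.Basis {T : RootedTree n // T.numIncreasing = i} R (Lie2Part R n i),
      ∀ T, ((B T : Lie2 R n) : FreeLie2 R (Fin n)) = mon R T.1.monomial := by
  have hli := (linearIndependent_treeMon R (n := n)).comp
    (fun T : {T : RootedTree n // T.numIncreasing = i} => T.1) Subtype.val_injective
  have e : Submodule.span R (Set.range (treeMon R n ∘
      fun T : {T : RootedTree n // T.numIncreasing = i} => T.1)) = Lie2Part R n i := by
    rw [lie2Part_eq, Set.range_comp, Subtype.range_coe_subtype]
  refine ⟨(Module.Basis.span hli).map (LinearEquiv.ofEq _ _ e), fun T => ?_⟩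
  rw [Module.Basis.map_apply, LinearEquiv.coe_ofEq_apply, Module.Basis.span_apply]
  rfl

end Basis

end CompatibleLie

theorem mainTheorem8 (R : Type*) [CommRing R] (n : ℕ) :
    DirectSum.IsInternal (fun i : Fin n => CompatibleLie.Lie2Part R n (i : ℕ)) ∧
    ∀ i : ℕ, i < n →
      Set.BijOn CompatibleLie.RootedTree.color
        {T : CompatibleLie.RootedTree n | T.numIncreasing = i}
        {G : CompatibleLie.TwoColoredGraph n |
          G ∈ CompatibleLie.TwoColoredGraph.avoidingTrees n ∧ G.numRed = i} ∧
      (∃ B : Module.Basis {T : CompatibleLie.RootedTree n // T.numIncreasing = i} R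
          (CompatibleLie.Lie2Part R n i),
        ∀ T, ((B T : CompatibleLie.Lie2 R n) : CompatibleLie.FreeLie2 R (Fin n)) =
          CompatibleLie.mon R T.1.monomial) ∧
      (Nontrivial R →
        Module.rank R (CompatibleLie.Lie2Part R n i) =
          Nat.card {T : CompatibleLie.RootedTree n // T.numIncreasing = i}) := by
  refine ⟨CompatibleLie.isInternal_lie2Part R n, fun i _ =>
    ⟨CompatibleLie.bijOn_color n i, CompatibleLie.exists_basis_lie2Part R n i, fun _ => ?_⟩⟩
  obtain ⟨B, -⟩ := CompatibleLie.exists_basis_lie2Part R n i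
  have := Fintype.ofFinite {T : CompatibleLie.RootedTree n // T.numIncreasing = i}
  rw [rank_eq_card_basis B, Nat.card_eq_fintype_card]
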